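/- **Setting.** Let $X$ be a Polish space, let $Y,\mathcal H_1,\mathcal H_2$ be real separable Hilbert spaces, where $\mathcal H_2$ is a vector-valued reproducing kernel Hilbert space of functions $X\to Y$ with $K_x:Y\to\mathcal H_2$ the adjoint of the evaluation $f\mapsto f(x)$. Assume $\kappa^2:=\sup_{x\in X}\|K_x\|_{HS}^2<\infty$ ($\|\cdot\|_{HS}$ the Hilbert–Schmidt norm) and that $(x,t)\mapsto\langle K_tv,K_xw\rangle_{\mathcal H_2}$ is measurable for all $v,w\in Y$. Let $\rho$ be a probability measure on $X\times Y$ with marginal $\rho_X$ on $X$ and conditional distributions $\rho(\cdot|x)$, let $I_K:\mathcal H_2\to\mathscr L^2(X,\rho_X;Y)$ be the canonical map, $L_K=I_K^*I_K$, and $\mathcal N(\lambda)=\operatorname{tr}\big((L_K+\lambda I)^{-1}L_K\big)$ the effective dimension. Let $A:\mathcal D(A)\subset\mathcal H_1\to\mathcal H_2$ be a (nonlinear) operator, $f_\rho\in\operatorname{int}\mathcal D(A)$, $\bar f\in\mathcal H_1$, and let $\gamma\ge 0$, $L$, $R>0$, $M>0$, $\Sigma>0$, $d$, $\lambda>0$,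 $0<\eta<1$, $m\in\mathbb N$, $m\geq 1$ be such that: 1. (True solution) for $\rho_X$-almost every $x$, $\int_Y\|y\|\,d\rho(y|x)<\infty$ and $\int_Y y\,d\rho(y|x)=A(f_\rho)(x)$. 2. (Noise) for $\rho_X$-almost every $x$, $\int_Y\big(e^{\|y-A(f_\rho)(x)\|/M}-\frac{\|y-A(f_\rho)(x)\|}{M}-1\big)d\rho(y|x)\le\frac{\Sigma^2}{2M^2}$. 3. (Nonlinearity) $\mathcal D(A)$ is convex with nonempty interior; $A$ is one-to-one and weakly sequentially closed (if $f_n\in\mathcal D(A)$, $f_n\rightharpoonup f$ in $\mathcal H_1$ and $I_KA(f_n)\rightharpoonup g$ in $\mathscr L^2(X,\rho_X;Y)$, then $f\in\mathcal D(A)$ and $I_KA(f)=g$); $A$ is Fréchet differentiable on $\mathcal D(A)$ and Lipschitz continuous on $\mathcal D(A)$ with constant $L$; and, for all $f\in\mathcal D(A)$ in the open ball $\mathcal B_d(f_\rho)$ of radius $d$ about $f_\rho$, $\|A'(f)\|\le L$ and $\|I_K(A(f)-A(f_\rho)-A'(f_\rho)(f-f_\rho))\|_{\mathscr L^2}\le\frac\gamma2\|f-f_\rho\|^2$.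 The ball is large enough that $d>4\|f_\rho-\bar f\|$. 4. (Source condition with $\phi(t)=\sqrt t$, and smallness) with $B=I_KA'(f_\rho)$ and $T=B^*B$ there is $w\in\mathcal H_1$ with $f_\rho-\bar f=T^{1/2}w$, $\|w\|\le R$ and $2\gamma\|w\|<1$. 5. (Sample size) $8\kappa^2\max\big(1,\frac{L(M+\Sigma)}{\kappa d}\big)\log\frac4\eta\le\sqrt m\,\lambda$. **Theorem.** There are constants $C_1,C_2>0$ depending only on $\gamma,L,R$ such that in this setting, for $\mathbf z=((x_i,y_i))_{i=1}^m$ drawn i.i.d. from $\rho$, with probability at least $1-\eta$ every minimizer $f_{\mathbf z,\lambda}$ over $\mathcal D(A)$ of $$f\mapsto\frac1m\sum_{i=1}^m\|A(f)(x_i)-y_i\|_Y^2+\lambda\|f-\bar f\|_{\mathcal H_1}^2$$ satisfies both $$\|f_{\mathbf z,\lambda}-f_\rho\|_{\mathcal H_1}\le C_1\Big(R\sqrt\lambda+\frac{\kappa M}{m\lambda}+\sqrt{\frac{\Sigma^2\mathcal N(\lambda)}{m\lambda}}\Big)\log\frac4\eta$$ and $$\|I_K(A(f_{\mathbf z,\lambda})-A(f_\rho))\|_{\mathscr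 L^2(X,\rho_X;Y)}\le C_2\sqrt\lambda\Big(R\sqrt\lambda+\frac{\kappa M}{m\lambda}+\sqrt{\frac{\Sigma^2\mathcal N(\lambda)}{m\lambda}}\Big)\log\frac4\eta .$$ -/

import Mathlib

open MeasureTheory ProbabilityTheory Filter Topology
open scoped RealInnerProductSpace ENNReal

noncomputable section

namespace StatInv

/-! ### Square root of a positive operator on a real Hilbert space

Mathlib's functional calculus covers operators on complex Hilbert spaces only, so the existence of
the square root is shown here with the binomial series. -/

/-- Taylor coefficients of `1 - √(1 - x)`: `sqrtCoeff n` is the coefficient of `x ^ (n + 1)`. -/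
def sqrtCoeff (n : ℕ) : ℝ := catalan n / (2 * 4 ^ n)

theorem sqrtCoeff_nonneg (n : ℕ) : 0 ≤ sqrtCoeff n := by
  unfold sqrtCoeff; positivity

theorem sqrtCoeff_eq_sub (n : ℕ) : sqrtCoeff n =
    (n.centralBinom : ℝ) / 4 ^ n - ((n + 1).centralBinom : ℝ) / 4 ^ (n + 1) := by
  have h1 : ((n : ℝ) + 1) * catalan n = n.centralBinom := by
    exact_mod_cast succ_mul_catalan_eq_centralBinom n
  have h2 : ((n : ℝ) + 1) * (n + 1).centralBinom = 2 * (2 * n + 1) * n.centralBinom := by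
    exact_mod_cast Nat.succ_mul_centralBinom_succ n
  have h3 : ((n + 1).centralBinom : ℝ) = 2 * (2 * n + 1) * catalan n := by
    rw [← h1] at h2
    have h4 : ((n : ℝ) + 1) ≠ 0 := by positivity
    apply mul_left_cancel₀ h4
    rw [h2]
    ring
  rw [sqrtCoeff, ← h1, h3, pow_succ]
  field_simp
  ring

theorem sum_sqrtCoeff_le (n : ℕ) : ∑ k ∈ Finset.range n, sqrtCoeff k ≤ 1 := by
  simp_rw [sqrtCoeff_eq_sub]
  rw [Finset.sum_range_sub' (fun k : ℕ => (k.centralBinom : ℝ) / 4 ^ k) n]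
  have : (0 : ℝ) ≤ (n.centralBinom : ℝ) / 4 ^ n := by positivity
  simpa using this

theorem summable_sqrtCoeff : Summable sqrtCoeff :=
  summable_of_sum_range_le sqrtCoeff_nonneg sum_sqrtCoeff_le

theorem sum_sqrtCoeff_mul (n : ℕ) :
    ∑ p ∈ Finset.HasAntidiagonal.antidiagonal n, sqrtCoeff p.1 * sqrtCoeff p.2 = 2 * sqrtCoeff (n + 1) := by
  have h : ∀ p ∈ Finset.HasAntidiagonal.antidiagonal n, sqrtCoeff p.1 * sqrtCoeff p.2 =
      ((catalan p.1 * catalan p.2 : ℕ) : ℝ) / (4 * 4 ^ n) := by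
    intro p hp
    rw [← Finset.HasAntidiagonal.mem_antidiagonal.1 hp, sqrtCoeff, sqrtCoeff, pow_add]
    push_cast
    field_simp
    ring
  rw [Finset.sum_congr rfl h, ← Finset.sum_div, ← Nat.cast_sum, ← catalan_succ', sqrtCoeff,
    pow_succ]
  field_simp

section Operators

variable {E : Type*} [NormedAddCommGroup E] [InnerProductSpace ℝ E] [CompleteSpace E]

theorem exists_isPositive_mul_self (T : E →L[ℝ] E) (hT : T.IsPositive) :
    ∃ S : E →L[ℝ] E, S.IsPositive ∧ S * S = T := by
  set c : ℝ := ‖T‖ + 1 with hc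
  have hc0 : 0 < c := by positivity
  set N : E →L[ℝ] E := c⁻¹ • T with hN
  have hNpos : N.IsPositive := hT.smul_of_nonneg (by positivity)
  have hN1 : ‖N‖ ≤ 1 := by
    rw [hN, norm_smul, Real.norm_of_nonneg (by positivity), inv_mul_le_iff₀ hc0]
    linarith
  set W : E →L[ℝ] E := 1 - N with hW
  have hWsa : IsSelfAdjoint W := (IsSelfAdjoint.one _).sub hNpos.isSelfAdjoint
  have hW1 : ‖W‖ ≤ 1 := by
    refine ContinuousLinearMap.opNorm_le_bound _ zero_le_one fun x => ?_
    have h1 : 0 ≤ ⟪N (x - N x), x - N x⟫ := hNpos.inner_nonneg_left _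
    have h2 : ⟪N (N x), x⟫ = ⟪N x, N x⟫ := hNpos.inner_left_eq_inner_right _ _
    have h3 : ⟪N (N x), N x⟫ ≤ ‖N x‖ ^ 2 := by
      refine (real_inner_le_norm _ _).trans ?_
      have := N.le_of_opNorm_le hN1 (N x)
      nlinarith [norm_nonneg (N x)]
    rw [map_sub, inner_sub_left, inner_sub_right, inner_sub_right, h2,
      real_inner_self_eq_norm_sq] at h1
    have h4 : ‖x - N x‖ ^ 2 ≤ ‖x‖ ^ 2 := by
      rw [norm_sub_sq_real, real_inner_comm]
      nlinarith [sq_nonneg ‖N x‖]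
    have h5 : W x = x - N x := by simp [hW]
    rw [h5, one_mul]
    exact (sq_le_sq₀ (norm_nonneg _) (norm_nonneg _)).1 h4
  have hWn : ∀ n : ℕ, ‖W ^ (n + 1)‖ ≤ 1 := fun n =>
    (norm_pow_le' W n.succ_pos).trans (pow_le_one₀ (norm_nonneg _) hW1)
  set a : ℕ → (E →L[ℝ] E) := fun n => sqrtCoeff n • W ^ (n + 1) with ha
  have hale : ∀ n, ‖a n‖ ≤ sqrtCoeff n := fun n => by
    rw [ha, norm_smul, Real.norm_of_nonneg (sqrtCoeff_nonneg n)]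
    exact mul_le_of_le_one_right (sqrtCoeff_nonneg n) (hWn n)
  have hasum : Summable fun n => ‖a n‖ :=
    Summable.of_nonneg_of_le (fun _ => norm_nonneg _) hale summable_sqrtCoeff
  set P : E →L[ℝ] E := ∑' n, a n with hP
  have hP1 : ‖P‖ ≤ 1 :=
    (tsum_of_norm_bounded summable_sqrtCoeff.hasSum hale).trans
      (Real.tsum_le_of_sum_range_le sqrtCoeff_nonneg sum_sqrtCoeff_le)
  have hPP : P * P = 2 • P - W := by
    rw [hP, tsum_mul_tsum_eq_tsum_sum_antidiagonal_of_summable_norm hasum hasum]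
    have h1 : ∀ n, ∑ p ∈ Finset.HasAntidiagonal.antidiagonal n, a p.1 * a p.2 = 2 • a (n + 1) := by
      intro n
      have h : ∀ p ∈ Finset.HasAntidiagonal.antidiagonal n, a p.1 * a p.2 =
          (sqrtCoeff p.1 * sqrtCoeff p.2) • W ^ (n + 2) := by
        intro p hp
        rw [ha]
        simp only [smul_mul_smul_comm, ← pow_add]
        rw [← Finset.HasAntidiagonal.mem_antidiagonal.1 hp]
        congr 2
        ring
      rw [Finset.sum_congr rfl h, ← Finset.sum_smul, sum_sqrtCoeff_mul, mul_smul]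
      simp [ha, two_smul]
    simp_rw [h1]
    rw [hasum.of_norm.tsum_eq_zero_add, Summable.tsum_const_smul _
      ((summable_nat_add_iff 1).2 hasum.of_norm)]
    have h0 : 2 • a 0 = W := by
      rw [ha]
      simp only [sqrtCoeff, catalan_zero, zero_add, pow_zero, pow_one, Nat.cast_one, mul_one]
      rw [two_smul, ← add_smul]
      norm_num
    rw [smul_add, h0]
    abel
  have hPsa : IsSelfAdjoint P := by
    rw [IsSelfAdjoint, hP, tsum_star]
    congr 1
    funext n
    rw [ha]
    simp only [star_smul, star_pow, hWsa.star_eq, star_trivial]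
  refine ⟨√c • (1 - P), ?_, ?_⟩
  · refine ContinuousLinearMap.IsPositive.smul_of_nonneg ?_ (Real.sqrt_nonneg c)
    rw [ContinuousLinearMap.isPositive_iff']
    refine ⟨(IsSelfAdjoint.one _).sub hPsa, fun x => ?_⟩
    have h1 : (1 - P) x = x - P x := by simp
    rw [h1, inner_sub_left, real_inner_self_eq_norm_sq]
    have h2 := (real_inner_le_norm (P x) x)
    have h3 := P.le_of_opNorm_le hP1 x
    nlinarith [norm_nonneg x]
  · rw [smul_mul_smul_comm, Real.mul_self_sqrt hc0.le]
    have h1 : (1 - P) * (1 - P) = N := by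
      have : (1 - P) * (1 - P) = 1 - 2 • P + P * P := by noncomm_ring
      rw [this, hPP, hW]
      abel
    rw [h1, hN, smul_smul, mul_inv_cancel₀ hc0.ne', one_smul]

/-- The (unique) positive square root `T^{1/2}` of a positive operator `T`. -/
def opSqrt (T : E →L[ℝ] E) (hT : T.IsPositive) : E →L[ℝ] E :=
  Classical.choose (exists_isPositive_mul_self T hT)

theorem opSqrt_isPositive (T : E →L[ℝ] E) (hT : T.IsPositive) : (opSqrt T hT).IsPositive :=
  (Classical.choose_spec (exists_isPositive_mul_self T hT)).1

theorem opSqrt_mul_self (T : E →L[ℝ] E) (hT : T.IsPositive) :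
    opSqrt T hT * opSqrt T hT = T :=
  (Classical.choose_spec (exists_isPositive_mul_self T hT)).2

end Operators

/-! ### Hilbert-Schmidt norm and trace -/

/-- Index set of a fixed Hilbert basis of `E`. -/
def stdBasisIndex (E : Type*) [NormedAddCommGroup E] [InnerProductSpace ℝ E] [CompleteSpace E] :
    Set E :=
  Classical.choose (exists_hilbertBasis ℝ E)

/-- A fixed Hilbert basis of `E`. -/
def stdBasis (E : Type*) [NormedAddCommGroup E] [InnerProductSpace ℝ E] [CompleteSpace E] :
    HilbertBasis (stdBasisIndex E) ℝ E :=
  Classical.choose (Classical.choose_spec (exists_hilbertBasis ℝ E))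

theorem stdBasis_apply {E : Type*} [NormedAddCommGroup E] [InnerProductSpace ℝ E] [CompleteSpace E]
    (i : stdBasisIndex E) : stdBasis E i = i :=
  congrFun (Classical.choose_spec (Classical.choose_spec (exists_hilbertBasis ℝ E))) i

section Operators

variable {E F : Type*} [NormedAddCommGroup E] [InnerProductSpace ℝ E] [CompleteSpace E]
  [NormedAddCommGroup F] [InnerProductSpace ℝ F] [CompleteSpace F]

/-- Squared Hilbert-Schmidt norm `‖S‖²_HS = tr (S* S)` (it does not depend on the basis); it is
infinite when `S` is not a Hilbert-Schmidt operator. -/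
def hsNormSq (S : E →L[ℝ] F) : ℝ≥0∞ := ∑' i, ‖S (stdBasis E i)‖ₑ ^ 2

/-- Trace of a trace-class operator (it does not depend on the basis). -/
def opTrace (S : E →L[ℝ] E) : ℝ := ∑' i, ⟪S (stdBasis E i), stdBasis E i⟫

theorem enorm_adjoint_apply_sq_le (S : E →L[ℝ] F) (f : F) :
    ‖S.adjoint f‖ₑ ^ 2 ≤ hsNormSq S * ‖f‖ₑ ^ 2 := by
  have h1 : ∑' i, ‖⟪stdBasis E i, S.adjoint f⟫‖ₑ ^ 2 = ‖S.adjoint f‖ₑ ^ 2 := by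
    have h := (stdBasis E).hasSum_inner_mul_inner (S.adjoint f) (S.adjoint f)
    have h' : HasSum (fun i => ‖⟪stdBasis E i, S.adjoint f⟫‖ ^ 2) (‖S.adjoint f‖ ^ 2) := by
      rw [← real_inner_self_eq_norm_sq]
      have e : (fun i => ‖⟪stdBasis E i, S.adjoint f⟫‖ ^ 2) =
          fun i => ⟪S.adjoint f, stdBasis E i⟫ * ⟪stdBasis E i, S.adjoint f⟫ := by
        funext i
        rw [real_inner_comm (stdBasis E i) (S.adjoint f), Real.norm_eq_abs, sq_abs, sq]
      rw [e]
      exact h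
    have h2 := ENNReal.ofReal_tsum_of_nonneg (fun i => by positivity) h'.summable
    rw [h'.tsum_eq] at h2
    simp only [ENNReal.ofReal_pow (norm_nonneg _), ofReal_norm] at h2
    exact h2.symm
  rw [← h1, hsNormSq, ← ENNReal.tsum_mul_right]
  refine ENNReal.tsum_le_tsum fun i => ?_
  rw [ContinuousLinearMap.adjoint_inner_right, ← mul_pow]
  gcongr
  rw [← ofReal_norm, ← ofReal_norm, ← ofReal_norm, ← ENNReal.ofReal_mul (norm_nonneg _)]
  exact ENNReal.ofReal_le_ofReal (norm_inner_le_norm _ _)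

end Operators

/-! ### The vector-valued reproducing kernel Hilbert space and the map `I_K` -/

section Kernel

variable {X Y : Type*} [NormedAddCommGroup Y] [InnerProductSpace ℝ Y] [CompleteSpace Y]
  (H : Type*) [NormedAddCommGroup H] [InnerProductSpace ℝ H] [CompleteSpace H] [RKHS ℝ H X Y]

/-- `κ² = sup_x ‖K_x‖²_HS`, where `K_x = RKHS.kerFun H x : Y → H`. -/
def kappaSq : ℝ≥0∞ := ⨆ x, hsNormSq (RKHS.kerFun H x)

/-- The constant `κ`. -/
def kappa : ℝ := √(kappaSq H).toReal

/-- The assumptions on the reproducing kernel: the `K_x` are uniformly bounded Hilbert-Schmidt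
operators, and the functions `(x, t) ↦ ⟪K_t v, K_x w⟫` are measurable. -/
structure KernelAssumption [MeasurableSpace X] : Prop where
  kappaSq_lt_top : kappaSq H < ⊤
  measurable_kernel : ∀ v w : Y,
    Measurable fun p : X × X => ⟪RKHS.kerFun H p.2 v, RKHS.kerFun H p.1 w⟫

variable {H}

theorem norm_eval_le (hK : kappaSq H < ⊤) (f : H) (x : X) : ‖f x‖ ≤ kappa H * ‖f‖ := by
  have h := enorm_adjoint_apply_sq_le (RKHS.kerFun H x) f
  rw [RKHS.adjoint_kerFun] at h
  have h2 : ‖f x‖ₑ ^ 2 ≤ kappaSq H * ‖f‖ₑ ^ 2 :=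
    h.trans (by gcongr; exact le_iSup (fun x => hsNormSq (RKHS.kerFun H x)) x)
  have h3 := ENNReal.toReal_mono (ENNReal.mul_ne_top hK.ne (by simp)) h2
  rw [ENNReal.toReal_mul, ENNReal.toReal_pow, ENNReal.toReal_pow, toReal_enorm, toReal_enorm] at h3
  refine abs_le_of_sq_le_sq' ?_ (by unfold kappa; positivity) |>.2
  rw [mul_pow, kappa, Real.sq_sqrt ENNReal.toReal_nonneg]
  exact h3

variable [MeasurableSpace X]

theorem measurable_inner_apply (hK : KernelAssumption H) (f : H) (w : Y) :
    Measurable fun x => ⟪f x, w⟫ := by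
  let V : Submodule ℝ H :=
    { carrier := {f | Measurable fun x => ⟪f x, w⟫}
      add_mem' := fun {a b} ha hb => by
        simpa [inner_add_left] using! Measurable.add ha hb
      zero_mem' := by simp
      smul_mem' := fun c a ha => by
        simpa [inner_smul_left] using! Measurable.const_mul ha c }
  have hclosed : IsClosed (V : Set H) := by
    refine IsSeqClosed.isClosed fun u g hu hg => ?_
    have hlim : Tendsto (fun n x => ⟪u n x, w⟫) atTop (𝓝 fun x => ⟪g x, w⟫) := by
      rw [tendsto_pi_nhds]
      intro x
      exact Tendsto.inner (((RKHS.continuous_eval x).tendsto g).comp hg) tendsto_const_nhds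
    exact measurable_of_tendsto_metrizable (fun n => hu n) hlim
  have hspan : Submodule.span ℝ {RKHS.kerFun H x v | (x) (v)} ≤ V := by
    rw [Submodule.span_le]
    rintro _ ⟨t, v, rfl⟩
    have h1 : Measurable fun x => ⟪RKHS.kerFun H t v, RKHS.kerFun H x w⟫ :=
      Measurable.comp (g := fun p : X × X => ⟪RKHS.kerFun H p.2 v, RKHS.kerFun H p.1 w⟫)
        (f := fun x => (x, t)) (hK.measurable_kernel v w) measurable_prodMk_right
    have h2 : (fun x => ⟪RKHS.kerFun H t v, RKHS.kerFun H x w⟫) =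
        fun x => ⟪RKHS.kerFun H t v x, w⟫ :=
      funext fun x => RKHS.inner_kerFun x w _
    rw [h2] at h1
    exact h1
  have hf : f ∈ (Submodule.span ℝ {RKHS.kerFun H x v | (x) (v)}).topologicalClosure := by
    rw [RKHS.kerFun_dense H]
    exact Submodule.mem_top
  exact Submodule.topologicalClosure_minimal _ hspan hclosed hf

variable [MeasurableSpace Y] [BorelSpace Y] [SecondCountableTopology Y]

theorem measurable_apply (hK : KernelAssumption H) (f : H) : Measurable fun x => f x := by
  have : DiscreteTopology (stdBasisIndex Y) := by
    refine DiscreteTopology.of_forall_le_dist zero_lt_one fun i j hij => ?_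
    have h := (stdBasis Y).orthonormal
    have hd : ‖stdBasis Y i - stdBasis Y j‖ ^ 2 = 2 := by
      rw [norm_sub_sq_real, h.1 i, h.1 j, h.2 hij]
      norm_num
    change 1 ≤ dist i j
    rw [Subtype.dist_eq, dist_eq_norm, ← stdBasis_apply, ← stdBasis_apply]
    nlinarith [norm_nonneg (stdBasis Y i - stdBasis Y j)]
  have : Countable (stdBasisIndex Y) := TopologicalSpace.separableSpace_iff_countable.1 inferInstance
  refine measurable_of_tendsto_metrizable' (atTop : Filter (Finset (stdBasisIndex Y)))
    (f := fun s x => ∑ i ∈ s, (stdBasis Y).repr (f x) i • stdBasis Y i) (fun s => ?_) ?_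
  · refine Finset.measurable_sum _ fun i _ => Measurable.smul_const ?_ _
    simp_rw [HilbertBasis.repr_apply_apply, real_inner_comm]
    exact measurable_inner_apply hK f _
  · rw [tendsto_pi_nhds]
    exact fun x => (stdBasis Y).hasSum_repr (f x)

theorem memLp_apply (hK : KernelAssumption H) (ν : Measure X) [IsFiniteMeasure ν] (f : H) :
    MemLp (fun x => f x) 2 ν :=
  MemLp.of_bound (measurable_apply hK f).aestronglyMeasurable (kappa H * ‖f‖)
    (Eventually.of_forall fun x => norm_eval_le hK.kappaSq_lt_top f x)

/-- The canonical map `I_K : H → L²(X, ν; Y)`. -/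
def IK (hK : KernelAssumption H) (ν : Measure X) [IsFiniteMeasure ν] : H →L[ℝ] Lp Y 2 ν :=
  LinearMap.mkContinuousOfExistsBound
    { toFun := fun f => (memLp_apply hK ν f).toLp
      map_add' := fun f g => by
        rw [← MemLp.toLp_add]
        congr 1
        funext x
        simp
      map_smul' := fun c f => by
        rw [RingHom.id_apply, ← MemLp.toLp_const_smul]
        congr 1
        funext x
        simp }
    ⟨(measureUnivNNReal ν : ℝ) ^ (2 : ℝ≥0∞).toReal⁻¹ * kappa H, fun f => by
      rw [mul_assoc]
      refine Lp.norm_le_of_ae_bound (mul_nonneg (Real.sqrt_nonneg _) (norm_nonneg f)) ?_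
      filter_upwards [(memLp_apply hK ν f).coeFn_toLp] with x hx
      change ‖(memLp_apply hK ν f).toLp _ x‖ ≤ _
      rw [hx]
      exact norm_eval_le hK.kappaSq_lt_top f x⟩

/-- The covariance operator `L_K = I_K* I_K`. -/
def LK (hK : KernelAssumption H) (ν : Measure X) [IsFiniteMeasure ν] : H →L[ℝ] H :=
  (IK hK ν).adjoint ∘L IK hK ν

/-- The effective dimension `N(lam) = tr ((L_K + lam I)⁻¹ L_K)`. -/
def effectiveDim (hK : KernelAssumption H) (ν : Measure X) [IsFiniteMeasure ν] (lam : ℝ) : ℝ :=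
  opTrace (Ring.inverse (LK hK ν + lam • (1 : H →L[ℝ] H)) * LK hK ν)

end Kernel

/-! ### The statistical inverse problem -/

section Model

variable {X Y H₁ H₂ : Type*}
  [MeasurableSpace X]
  [NormedAddCommGroup Y] [InnerProductSpace ℝ Y] [CompleteSpace Y] [SecondCountableTopology Y]
  [MeasurableSpace Y] [BorelSpace Y]
  [NormedAddCommGroup H₁] [InnerProductSpace ℝ H₁] [CompleteSpace H₁]
  [NormedAddCommGroup H₂] [InnerProductSpace ℝ H₂] [CompleteSpace H₂] [RKHS ℝ H₂ X Y]

/-- The operator `B = I_K ∘ A'(f₀)`; the derivative is taken within the domain `D` of `A`. -/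
def opB (hK : KernelAssumption H₂) (ν : Measure X) [IsFiniteMeasure ν]
    (D : Set H₁) (A : H₁ → H₂) (f₀ : H₁) : H₁ →L[ℝ] Lp Y 2 ν :=
  IK hK ν ∘L fderivWithin ℝ A D f₀

/-- The operator `T = B* B`. -/
def opT (hK : KernelAssumption H₂) (ν : Measure X) [IsFiniteMeasure ν]
    (D : Set H₁) (A : H₁ → H₂) (f₀ : H₁) : H₁ →L[ℝ] H₁ :=
  (opB hK ν D A f₀).adjoint ∘L opB hK ν D A f₀

theorem opT_isPositive (hK : KernelAssumption H₂) (ν : Measure X) [IsFiniteMeasure ν]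
    (D : Set H₁) (A : H₁ → H₂) (f₀ : H₁) : (opT hK ν D A f₀).IsPositive :=
  ContinuousLinearMap.isPositive_adjoint_comp_self _

/-- `f₀ ∈ int D` is the true solution: the conditional mean of `y` given `x` under `ρ` exists and
equals `A(f₀)(x)`. -/
structure IsTrueSolution (ρ : Measure (X × Y)) [IsFiniteMeasure ρ]
    (D : Set H₁) (A : H₁ → H₂) (f₀ : H₁) : Prop where
  mem_interior : f₀ ∈ interior D
  integrable : ∀ᵐ x ∂ρ.fst, Integrable (fun y : Y => y) (ρ.condKernel x)
  condMean_eq : ∀ᵐ x ∂ρ.fst, ∫ y, y ∂(ρ.condKernel x) = A f₀ x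

/-- The Bernstein-type noise condition with constants `M` and `Sig`. -/
def NoiseCondition (ρ : Measure (X × Y)) [IsFiniteMeasure ρ]
    (A : H₁ → H₂) (f₀ : H₁) (M Sig : ℝ) : Prop :=
  ∀ᵐ x ∂ρ.fst,
    ∫⁻ y, ENNReal.ofReal (Real.exp (‖y - A f₀ x‖ / M) - ‖y - A f₀ x‖ / M - 1) ∂(ρ.condKernel x)
      ≤ ENNReal.ofReal (Sig ^ 2 / (2 * M ^ 2))

/-- `A : D ⊆ H₁ → H₂ → L²(ν)` is weakly sequentially closed. -/
def WeaklySeqClosed (hK : KernelAssumption H₂) (ν : Measure X) [IsFiniteMeasure ν]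
    (D : Set H₁) (A : H₁ → H₂) : Prop :=
  ∀ (u : ℕ → H₁) (f : H₁) (g : Lp Y 2 ν), (∀ n, u n ∈ D) →
    (∀ h : H₁, Tendsto (fun n => ⟪u n, h⟫) atTop (𝓝 ⟪f, h⟫)) →
    (∀ h : Lp Y 2 ν, Tendsto (fun n => ⟪IK hK ν (A (u n)), h⟫) atTop (𝓝 ⟪g, h⟫)) →
    f ∈ D ∧ IK hK ν (A f) = g

/-- The assumptions on the nonlinear operator `A` with domain `D` (values of `A` outside `D` play
no role). -/
structure NonlinearityAssumption (hK : KernelAssumption H₂) (ν : Measure X) [IsFiniteMeasure ν]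
    (D : Set H₁) (A : H₁ → H₂) (f₀ : H₁) (d L γ : ℝ) : Prop where
  convex : Convex ℝ D
  interior_nonempty : (interior D).Nonempty
  weaklySeqClosed : WeaklySeqClosed hK ν D A
  injOn : Set.InjOn A D
  differentiableOn : DifferentiableOn ℝ A D
  norm_fderiv_le : ∀ f ∈ Metric.ball f₀ d ∩ D, ‖fderivWithin ℝ A D f‖ ≤ L
  lipschitz : ∀ f ∈ D, ∀ g ∈ D, ‖A f - A g‖ ≤ L * ‖f - g‖
  norm_remainder_le : ∀ f ∈ Metric.ball f₀ d ∩ D,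
    ‖IK hK ν (A f - A f₀ - fderivWithin ℝ A D f₀ (f - f₀))‖ ≤ γ / 2 * ‖f - f₀‖ ^ 2

/-- The Tikhonov functional for the sample `z`, with initial guess `fbar`. -/
def tikhonov (A : H₁ → H₂) (fbar : H₁) (lam : ℝ) {m : ℕ} (z : Fin m → X × Y) (f : H₁) : ℝ :=
  (1 / (m : ℝ)) * ∑ i, ‖A f (z i).1 - (z i).2‖ ^ 2 + lam * ‖f - fbar‖ ^ 2

/-- `f` is a regularized least-squares estimator `f_{z,lam}` (not necessarily unique). -/
def IsTikhonovEstimator (D : Set H₁) (A : H₁ → H₂) (fbar : H₁) (lam : ℝ) {m : ℕ}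
    (z : Fin m → X × Y) (f : H₁) : Prop :=
  f ∈ D ∧ ∀ h ∈ D, tikhonov A fbar lam z f ≤ tikhonov A fbar lam z h

/-- The bound `R √lam + κ M / (m lam) + √(Sig² N(lam) / (m lam))`. -/
def errorBound (hK : KernelAssumption H₂) (ν : Measure X) [IsFiniteMeasure ν]
    (R M Sig lam : ℝ) (m : ℕ) : ℝ :=
  R * √lam + kappa H₂ * M / (m * lam) + √(Sig ^ 2 * effectiveDim hK ν lam / (m * lam))

end Model

end StatInv

end

/-! Put `u = A f - A fρ`, `e = ‖f - fρ‖`, `a = ‖I_K u‖` and `v = √λ e`. Comparing the Tikhonov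
functional at a minimizer and at the true solution bounds the empirical norm of `u` squared plus
`v²` by a noise term plus a bias term (`IsTikhonovEstimator.basic_inequality`). The argument brings
everything back to the two unknowns `a` and `v`.

Bias: the source condition moves `T^{1/2}` onto `f - fρ`, where it has the same norm as `B`, so the
bias is at most `2λ‖w‖ (a + γ e²/2)`. Since `2γ‖w‖ < 1`, the curvature part uses up only half of
`v²`. The Taylor estimate holds near `fρ` only, so `IsTikhonovEstimator.norm_sub_lt` first confines
the minimizer to the ball.

Noise: with `G = (L_K + λ)^{1/2}` and `Q = G⁻¹`, `⟪u, s⟫ = ⟪G u, Q s⟫` and `‖G u‖ ≤ a + L v`. The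
variance of `Q s` is governed by the effective dimension.

Empirical norm: it dominates `a²` up to `(3/2) λ ‖u‖²`, simultaneously for all `u`, which permits
the data-dependent choice. The Lipschitz bound turns the defect into `(3/2) L² v²`; this may exceed
the penalty, but `bounds_of_quadratic_inequality` absorbs it by reweighting, at the price of a
factor `6 L² + 1`.

The three random quantities (noise, noise weighted by `Q`, centered covariance) are controlled by
one Hilbert space Bernstein inequality, `measure_norm_sum_ge_le`, obtained by following the
expectation of `cosh ‖∑ ξ‖` as summands are added. -/

noncomputable section

namespace StatInv

/-! ### A Bernstein inequality in Hilbert spaces -/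

/-- The function `t ↦ eᵗ - t - 1` of the Bernstein condition. -/
def expRem (t : ℝ) : ℝ := Real.exp t - t - 1

theorem expRem_nonneg (t : ℝ) : 0 ≤ expRem t := by
  have := Real.add_one_le_exp t
  unfold expRem; linarith

theorem sq_div_two_le_expRem {t : ℝ} (ht : 0 ≤ t) : t ^ 2 / 2 ≤ expRem t := by
  have := Real.quadratic_le_exp_of_nonneg ht
  unfold expRem; linarith

theorem continuous_expRem : Continuous expRem := by
  unfold expRem; fun_prop

theorem hasSum_expRem (t : ℝ) :
    HasSum (fun n : ℕ => t ^ (n + 2) / ((n + 2).factorial : ℝ)) (expRem t) := by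
  have h : HasSum (fun n : ℕ => t ^ n / (n.factorial : ℝ)) (Real.exp t) := by
    rw [Real.exp_eq_exp_ℝ]
    exact NormedSpace.expSeries_div_hasSum_exp t
  have h2 : expRem t = Real.exp t - ∑ n ∈ Finset.range 2, t ^ n / (n.factorial : ℝ) := by
    simp [expRem, Finset.sum_range_succ]
    ring
  rw [h2]
  exact (hasSum_nat_add_iff' 2).2 h

theorem expRem_mono {s t : ℝ} (hs : 0 ≤ s) (hst : s ≤ t) : expRem s ≤ expRem t :=
  hasSum_le (fun n => by gcongr) (hasSum_expRem s) (hasSum_expRem t)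

/-- The power series starts in degree two, so every term gains at least the factor `s ^ 2`. This
makes an exponential moment behave like a variance under scaling. -/
theorem expRem_mul_le {s t : ℝ} (hs : 0 ≤ s) (hs1 : s ≤ 1) (ht : 0 ≤ t) :
    expRem (s * t) ≤ s ^ 2 * expRem t := by
  refine hasSum_le (fun n => ?_) (hasSum_expRem (s * t)) ((hasSum_expRem t).mul_left (s ^ 2))
  rw [mul_pow, mul_div_assoc]
  exact mul_le_mul_of_nonneg_right (pow_le_pow_of_le_one hs hs1 (Nat.le_add_left 2 n))
    (by positivity)

/-- `cosh` is a power series in the square of its argument with nonnegative coefficients, hence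
convex in that square. -/
theorem cosh_le_of_sq_eq_convex_comb {p a b c : ℝ} (hp : 0 ≤ p) (hp1 : p ≤ 1)
    (h : c ^ 2 = p * a ^ 2 + (1 - p) * b ^ 2) :
    Real.cosh c ≤ p * Real.cosh a + (1 - p) * Real.cosh b := by
  refine hasSum_le (fun n => ?_) (Real.hasSum_cosh c)
    (((Real.hasSum_cosh a).mul_left p).add ((Real.hasSum_cosh b).mul_left (1 - p)))
  rw [pow_mul, pow_mul, pow_mul, h, ← mul_div_assoc, ← mul_div_assoc, ← add_div]
  gcongr
  have := (convexOn_pow n).2 (x := a ^ 2) (y := b ^ 2) (sq_nonneg a) (sq_nonneg b) hp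
    (sub_nonneg.2 hp1) (by ring)
  simpa using this

section Hilbert

variable {H : Type*} [NormedAddCommGroup H] [InnerProductSpace ℝ H]

/-- If `c` is the cosine of the angle, `‖x + y‖²` is the mean of `(‖x‖ + ‖y‖)²` and `(‖x‖ - ‖y‖)²`
with weights `(1 ± c) / 2`, which gives `cosh ‖x‖ cosh ‖y‖ + c sinh ‖x‖ sinh ‖y‖`. The part linear
in `y` is kept apart because it averages to zero for centered `y`; the rest is absorbed using `c
sinh ‖x‖ ≤ cosh ‖x‖`. -/
theorem cosh_norm_add_le (x y : H) :
    Real.cosh ‖x + y‖ ≤ Real.cosh ‖x‖ * (1 + expRem ‖y‖)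
      + Real.sinh ‖x‖ / ‖x‖ * ⟪x, y⟫ := by
  obtain ⟨c, hc1, hc2, hc⟩ : ∃ c : ℝ, -1 ≤ c ∧ c ≤ 1 ∧ ⟪x, y⟫ = c * (‖x‖ * ‖y‖) := by
    have habs := abs_le.1 (abs_real_inner_div_norm_mul_norm_le_one x y)
    refine ⟨_, habs.1, habs.2, ?_⟩
    by_cases h : ‖x‖ * ‖y‖ = 0
    · have := abs_real_inner_le_norm x y
      rw [h] at this ⊢
      simpa using this
    · rw [div_mul_cancel₀ _ h]
  have h1 := cosh_le_of_sq_eq_convex_comb (p := (1 + c) / 2) (a := ‖x‖ + ‖y‖) (b := ‖x‖ - ‖y‖)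
    (c := ‖x + y‖) (by linarith) (by linarith) (by rw [norm_add_sq_real, hc]; ring)
  have h2 : Real.sinh ‖x‖ / ‖x‖ * ⟪x, y⟫ = c * Real.sinh ‖x‖ * ‖y‖ := by
    rw [hc]
    by_cases h : ‖x‖ = 0
    · simp [h]
    · field_simp
  have h3 : c * Real.sinh ‖x‖ ≤ Real.cosh ‖x‖ := by
    have h4 : 0 ≤ Real.sinh ‖x‖ := Real.sinh_nonneg_iff.2 (norm_nonneg x)
    have h5 := (Real.sinh_lt_cosh ‖x‖).le
    nlinarith
  have h6 : ‖y‖ ≤ Real.sinh ‖y‖ := Real.self_le_sinh_iff.2 (norm_nonneg y)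
  have h7 : Real.exp ‖y‖ = Real.cosh ‖y‖ + Real.sinh ‖y‖ := (Real.cosh_add_sinh _).symm
  rw [h2, expRem, h7]
  rw [Real.cosh_add, Real.cosh_sub] at h1
  nlinarith [mul_le_mul_of_nonneg_right h3 (sub_nonneg.2 h6)]

section Bernstein

variable {Ω : Type*} [MeasurableSpace Ω] {μ : Measure Ω} [IsProbabilityMeasure μ]

/-- Centering kills the linear term of `cosh_norm_add_le`, so one more independent summand costs
only a factor `1 + a`. -/
theorem lintegral_cosh_norm_add_le {ξ : Ω → H} (hξ : StronglyMeasurable ξ)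
    (hint : ∀ v, Integrable (fun ω => ⟪v, ξ ω⟫) μ) (hmean : ∀ v, ∫ ω, ⟪v, ξ ω⟫ ∂μ = 0)
    {a : ℝ} (ha : 0 ≤ a) (hexp : ∫⁻ ω, ENNReal.ofReal (expRem ‖ξ ω‖) ∂μ ≤ ENNReal.ofReal a)
    (x : H) :
    ∫⁻ ω, ENNReal.ofReal (Real.cosh ‖x + ξ ω‖) ∂μ ≤
      ENNReal.ofReal (Real.cosh ‖x‖) * ENNReal.ofReal (1 + a) := by
  have hm : AEStronglyMeasurable (fun ω => expRem ‖ξ ω‖) μ :=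
    (continuous_expRem.comp_stronglyMeasurable hξ.norm).aestronglyMeasurable
  have hi : Integrable (fun ω => expRem ‖ξ ω‖) μ := by
    refine (lintegral_ofReal_ne_top_iff_integrable hm
      (Eventually.of_forall fun ω => expRem_nonneg _)).1 ?_
    exact (hexp.trans_lt ENNReal.ofReal_lt_top).ne
  have hle : ∫ ω, expRem ‖ξ ω‖ ∂μ ≤ a := by
    rw [integral_eq_lintegral_of_nonneg_ae (Eventually.of_forall fun ω => expRem_nonneg _) hm]
    exact ENNReal.toReal_le_of_le_ofReal ha hexp
  have hi1 : Integrable (fun ω => 1 + expRem ‖ξ ω‖) μ := (integrable_const 1).add hi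
  have hi2 : Integrable (fun ω => Real.cosh ‖x‖ * (1 + expRem ‖ξ ω‖)
      + Real.sinh ‖x‖ / ‖x‖ * ⟪x, ξ ω⟫) μ :=
    (hi1.const_mul _).add ((hint x).const_mul _)
  calc ∫⁻ ω, ENNReal.ofReal (Real.cosh ‖x + ξ ω‖) ∂μ
      ≤ ∫⁻ ω, ENNReal.ofReal (Real.cosh ‖x‖ * (1 + expRem ‖ξ ω‖)
          + Real.sinh ‖x‖ / ‖x‖ * ⟪x, ξ ω⟫) ∂μ :=
        lintegral_mono fun ω => ENNReal.ofReal_le_ofReal (cosh_norm_add_le x (ξ ω))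
    _ = ENNReal.ofReal (∫ ω, (Real.cosh ‖x‖ * (1 + expRem ‖ξ ω‖)
          + Real.sinh ‖x‖ / ‖x‖ * ⟪x, ξ ω⟫) ∂μ) := by
        rw [ofReal_integral_eq_lintegral_ofReal hi2]
        exact Eventually.of_forall fun ω => (Real.cosh_pos _).le.trans (cosh_norm_add_le x (ξ ω))
    _ ≤ ENNReal.ofReal (Real.cosh ‖x‖ * (1 + a)) := by
        refine ENNReal.ofReal_le_ofReal ?_
        rw [integral_add (hi1.const_mul _) ((hint x).const_mul _),
          integral_const_mul, integral_const_mul, hmean, mul_zero, add_zero,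
          integral_add (integrable_const 1) hi]
        have := Real.cosh_pos ‖x‖
        gcongr
        simp
    _ = _ := ENNReal.ofReal_mul (Real.cosh_pos _).le

omit [InnerProductSpace ℝ H] in
theorem stronglyMeasurable_sum_pi {ξ : Ω → H} (hξ : StronglyMeasurable ξ) (n : ℕ) :
    StronglyMeasurable fun z : Fin n → Ω => ∑ i, ξ (z i) :=
  Finset.stronglyMeasurable_fun_sum _ fun i _ => hξ.comp_measurable (measurable_pi_apply i)

theorem lintegral_cosh_norm_sum_le {ξ : Ω → H} (hξ : StronglyMeasurable ξ)
    (hint : ∀ v, Integrable (fun ω => ⟪v, ξ ω⟫) μ) (hmean : ∀ v, ∫ ω, ⟪v, ξ ω⟫ ∂μ = 0)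
    {a : ℝ} (ha : 0 ≤ a) (hexp : ∫⁻ ω, ENNReal.ofReal (expRem ‖ξ ω‖) ∂μ ≤ ENNReal.ofReal a)
    (n : ℕ) :
    ∫⁻ z, ENNReal.ofReal (Real.cosh ‖∑ i, ξ (z i)‖) ∂(Measure.pi fun _ : Fin n => μ) ≤
      ENNReal.ofReal ((1 + a) ^ n) := by
  induction n with
  | zero => simp
  | succ n ih =>
    have hF : Measurable fun p : Ω × (Fin n → Ω) =>
        ENNReal.ofReal (Real.cosh ‖(∑ i, ξ (p.2 i)) + ξ p.1‖) := by
      refine ENNReal.measurable_ofReal.comp (Real.continuous_cosh.measurable.comp ?_)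
      exact (((stronglyMeasurable_sum_pi hξ n).comp_measurable measurable_snd).add
        (hξ.comp_measurable measurable_fst)).norm.measurable
    have e := measurePreserving_piFinSuccAbove (fun _ : Fin (n + 1) => μ) 0
    have h1 : ∀ z : Fin (n + 1) → Ω, ENNReal.ofReal (Real.cosh ‖∑ i, ξ (z i)‖) =
        (fun p : Ω × (Fin n → Ω) => ENNReal.ofReal (Real.cosh ‖(∑ i, ξ (p.2 i)) + ξ p.1‖))
          (MeasurableEquiv.piFinSuccAbove (fun _ : Fin (n + 1) => Ω) 0 z) := by
      intro z
      rw [Fin.sum_univ_succ, add_comm]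
      rfl
    simp_rw [h1]
    -- The new variable is integrated first, with the partial sum of the others frozen.
    rw [e.lintegral_comp hF, lintegral_prod_symm _ hF.aemeasurable]
    calc _ ≤ ∫⁻ z, ENNReal.ofReal (Real.cosh ‖∑ i, ξ (z i)‖) * ENNReal.ofReal (1 + a)
          ∂(Measure.pi fun _ : Fin n => μ) :=
          lintegral_mono fun z => lintegral_cosh_norm_add_le hξ hint hmean ha hexp _
      _ ≤ _ := by
        rw [lintegral_mul_const' _ _ ENNReal.ofReal_ne_top, pow_succ,
          ENNReal.ofReal_mul (by positivity)]
        gcongr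

/-- A Bernstein inequality for sums of independent random vectors of a Hilbert space. -/
theorem measure_norm_sum_ge_le {ξ : Ω → H} (hξ : StronglyMeasurable ξ)
    (hint : ∀ v, Integrable (fun ω => ⟪v, ξ ω⟫) μ) (hmean : ∀ v, ∫ ω, ⟪v, ξ ω⟫ ∂μ = 0)
    {M S : ℝ} (hM : 0 < M) (hS : 0 ≤ S)
    (hexp : ∫⁻ ω, ENNReal.ofReal (expRem (‖ξ ω‖ / M)) ∂μ ≤ ENNReal.ofReal (S ^ 2 / (2 * M ^ 2)))
    (n : ℕ) (l : ℝ) :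
    Measure.pi (fun _ : Fin n => μ) {z | 2 * (M + S * √n) * l ≤ ‖∑ i, ξ (z i)‖} ≤
      ENNReal.ofReal (2 * Real.exp (1 / 2) * Real.exp (-(2 * l))) := by
  -- This scale makes both `t M ≤ 1`, as needed for `expRem_mul_le`, and `t S √n ≤ 1`, which keeps
  -- the product of the `n` factors below `exp (1/2)`.
  set t : ℝ := (M + S * √n)⁻¹ with ht
  have hpos : 0 < M + S * √n := by positivity
  have ht0 : 0 < t := by positivity
  have htM : t * M ≤ 1 := by
    rw [ht, inv_mul_le_iff₀ hpos]
    nlinarith [mul_nonneg hS (Real.sqrt_nonneg n)]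
  have htS : t * (S * √n) ≤ 1 := by
    rw [ht, inv_mul_le_iff₀ hpos]
    linarith
  have hexp' : ∫⁻ ω, ENNReal.ofReal (expRem ‖t • ξ ω‖) ∂μ ≤ ENNReal.ofReal ((t * S) ^ 2 / 2) := by
    calc ∫⁻ ω, ENNReal.ofReal (expRem ‖t • ξ ω‖) ∂μ
        ≤ ∫⁻ ω, ENNReal.ofReal ((t * M) ^ 2) * ENNReal.ofReal (expRem (‖ξ ω‖ / M)) ∂μ := by
          refine lintegral_mono fun ω => ?_
          rw [← ENNReal.ofReal_mul (by positivity)]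
          refine ENNReal.ofReal_le_ofReal ?_
          have : ‖t • ξ ω‖ = (t * M) * (‖ξ ω‖ / M) := by
            rw [norm_smul, Real.norm_of_nonneg ht0.le]
            field_simp
          rw [this]
          exact expRem_mul_le (by positivity) htM (by positivity)
      _ ≤ ENNReal.ofReal ((t * M) ^ 2) * ENNReal.ofReal (S ^ 2 / (2 * M ^ 2)) := by
          rw [lintegral_const_mul' _ _ ENNReal.ofReal_ne_top]
          gcongr
      _ = _ := by
          rw [← ENNReal.ofReal_mul (by positivity)]
          congr 1
          field_simp
  have key := lintegral_cosh_norm_sum_le (hξ.const_smul t)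
    (fun v => by simpa [inner_smul_right] using (hint v).const_mul t)
    (fun v => by simp [inner_smul_right, integral_const_mul, hmean])
    (by positivity) hexp' n
  have hpow : (1 + (t * S) ^ 2 / 2) ^ n ≤ Real.exp (1 / 2) := by
    calc (1 + (t * S) ^ 2 / 2) ^ n ≤ (Real.exp ((t * S) ^ 2 / 2)) ^ n := by
          gcongr
          linarith [Real.add_one_le_exp ((t * S) ^ 2 / 2)]
      _ = Real.exp ((t * (S * √n)) ^ 2 / 2) := by
          rw [← Real.exp_nat_mul, mul_pow, mul_pow, mul_pow, Real.sq_sqrt (Nat.cast_nonneg n)]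
          congr 1
          ring
      _ ≤ _ := by
          gcongr
          exact pow_le_one₀ (by positivity) htS
  have hmeas : Measurable fun z : Fin n → Ω =>
      ENNReal.ofReal (Real.cosh ‖∑ i, t • ξ (z i)‖) :=
    ENNReal.measurable_ofReal.comp (Real.continuous_cosh.measurable.comp
      (stronglyMeasurable_sum_pi (hξ.const_smul t) n).norm.measurable)
  -- Preparation for Markov's inequality. The bound `cosh r ≥ exp r / 2` is the source of the
  -- leading factor 2; it needs no sign for `l`.
  have hsub : {z : Fin n → Ω | 2 * (M + S * √n) * l ≤ ‖∑ i, ξ (z i)‖} ⊆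
      {z | ENNReal.ofReal (Real.exp (2 * l) / 2) ≤
        ENNReal.ofReal (Real.cosh ‖∑ i, t • ξ (z i)‖)} := by
    intro z hz
    refine ENNReal.ofReal_le_ofReal ?_
    have h1 : 2 * l ≤ ‖∑ i, t • ξ (z i)‖ := by
      rw [← Finset.smul_sum, norm_smul, Real.norm_of_nonneg ht0.le, ht, le_inv_mul_iff₀ hpos]
      have : 2 * (M + S * √n) * l ≤ ‖∑ i, ξ (z i)‖ := hz
      linarith
    rw [Real.cosh_eq]
    have h2 := Real.exp_le_exp.2 h1
    have h3 := Real.exp_pos (-‖∑ i, t • ξ (z i)‖)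
    linarith
  refine (measure_mono hsub).trans
    ((meas_ge_le_lintegral_div hmeas.aemeasurable ?_ ENNReal.ofReal_ne_top).trans ?_)
  · exact (ENNReal.ofReal_pos.2 (by positivity)).ne'
  · refine (ENNReal.div_le_div_right key _).trans ?_
    rw [← ENNReal.ofReal_div_of_pos (by positivity)]
    refine ENNReal.ofReal_le_ofReal ?_
    rw [div_le_iff₀ (by positivity)]
    refine hpow.trans (le_of_eq ?_)
    have : Real.exp (-(2 * l)) * Real.exp (2 * l) = 1 := by rw [← Real.exp_add]; simp
    linear_combination (-Real.exp (1 / 2)) * this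

end Bernstein

end Hilbert

/-! ### Hilbert-Schmidt norms and inverse square roots -/

section Operators

variable {E F G : Type*} [NormedAddCommGroup E] [InnerProductSpace ℝ E] [CompleteSpace E]
  [NormedAddCommGroup F] [InnerProductSpace ℝ F] [CompleteSpace F]
  [NormedAddCommGroup G] [InnerProductSpace ℝ G] [CompleteSpace G]

omit [CompleteSpace E] in
theorem tsum_enorm_inner_sq {ι : Type*} (b : HilbertBasis ι ℝ E) (f : E) :
    ∑' i, ‖⟪b i, f⟫‖ₑ ^ 2 = ‖f‖ₑ ^ 2 := by
  have h' : HasSum (fun i => ‖⟪b i, f⟫‖ ^ 2) (‖f‖ ^ 2) := by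
    rw [← real_inner_self_eq_norm_sq]
    refine (b.hasSum_inner_mul_inner f f).congr_fun fun i => ?_
    rw [real_inner_comm (b i) f, Real.norm_eq_abs, sq_abs, sq]
  have h2 := ENNReal.ofReal_tsum_of_nonneg (fun i => by positivity) h'.summable
  rw [h'.tsum_eq] at h2
  simp only [ENNReal.ofReal_pow (norm_nonneg _), ofReal_norm] at h2
  exact h2.symm

/-- By Parseval both sides are the same double sum of squared matrix entries, taken in opposite
orders. -/
theorem hsNormSq_adjoint (S : E →L[ℝ] F) : hsNormSq S.adjoint = hsNormSq S := by
  unfold hsNormSq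
  simp_rw [← tsum_enorm_inner_sq (stdBasis E) (S.adjoint _),
    ← tsum_enorm_inner_sq (stdBasis F) (S _), ContinuousLinearMap.adjoint_inner_right]
  rw [ENNReal.tsum_comm]
  simp_rw [real_inner_comm]

omit [CompleteSpace F] [CompleteSpace G] in
theorem hsNormSq_comp_le (S : F →L[ℝ] G) (U : E →L[ℝ] F) :
    hsNormSq (S ∘L U) ≤ ‖S‖ₑ ^ 2 * hsNormSq U := by
  unfold hsNormSq
  rw [← ENNReal.tsum_mul_left]
  refine ENNReal.tsum_le_tsum fun i => ?_
  rw [← mul_pow]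
  gcongr
  exact S.le_opENorm _

theorem countable_stdBasisIndex (E : Type*) [NormedAddCommGroup E] [InnerProductSpace ℝ E]
    [CompleteSpace E] [TopologicalSpace.SeparableSpace E] : Countable (stdBasisIndex E) := by
  have := UniformSpace.secondCountable_of_separable E
  have : DiscreteTopology (stdBasisIndex E) := by
    refine DiscreteTopology.of_forall_le_dist zero_lt_one fun i j hij => ?_
    have h := (stdBasis E).orthonormal
    have hd : ‖stdBasis E i - stdBasis E j‖ ^ 2 = 2 := by
      rw [norm_sub_sq_real, h.1 i, h.1 j, h.2 hij]
      norm_num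
    change 1 ≤ dist i j
    rw [Subtype.dist_eq, dist_eq_norm, ← stdBasis_apply, ← stdBasis_apply]
    nlinarith [norm_nonneg (stdBasis E i - stdBasis E j)]
  exact TopologicalSpace.separableSpace_iff_countable.1 inferInstance

omit [CompleteSpace E] in
-- Finite partial sums of the basis expansion converge pointwise; countability of `ι` makes the
-- filter of finite subsets countably generated.
theorem stronglyMeasurable_of_inner {ι Ω : Type*} [Countable ι] [MeasurableSpace Ω]
    (b : HilbertBasis ι ℝ E) {f : Ω → E} (hf : ∀ i, Measurable fun ω => ⟪b i, f ω⟫) :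
    StronglyMeasurable f := by
  refine stronglyMeasurable_of_tendsto (atTop : Filter (Finset ι))
    (f := fun s ω => ∑ i ∈ s, b.repr (f ω) i • b i) (fun s => ?_) ?_
  · refine Finset.stronglyMeasurable_fun_sum _ fun i _ => StronglyMeasurable.smul_const ?_ _
    simp_rw [HilbertBasis.repr_apply_apply]
    exact (hf i).stronglyMeasurable
  · rw [tendsto_pi_nhds]
    exact fun ω => b.hasSum_repr (f ω)

/-- The bilinear form of `T + lam` is coercive with constant `lam`, so Lax–Milgram applies. -/
theorem isUnit_add_smul_one {T : E →L[ℝ] E} (hT : T.IsPositive) {lam : ℝ} (hlam : 0 < lam) :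
    IsUnit (T + lam • (1 : E →L[ℝ] E)) := by
  set S := T + lam • (1 : E →L[ℝ] E) with hS
  have hc : IsCoercive ((innerSL ℝ : E →L[ℝ] E →L[ℝ] ℝ) ∘L S) := by
    refine ⟨lam, hlam, fun u => ?_⟩
    have h1 := hT.inner_nonneg_left u
    have h2 : ⟪S u, u⟫ = ⟪T u, u⟫ + lam * ‖u‖ ^ 2 := by
      simp [hS, inner_add_left, inner_smul_left]
    change _ ≤ ⟪S u, u⟫
    rw [h2]
    linarith
  have h : ⇑S = hc.continuousLinearEquivOfBilin := by
    funext u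
    refine hc.unique_continuousLinearEquivOfBilin fun w => ?_
    rfl
  rw [ContinuousLinearMap.isUnit_iff_bijective, h]
  exact hc.continuousLinearEquivOfBilin.bijective

/-- The square root `G` of `T + lam` and its inverse `Q`. -/
theorem exists_sqrt_add_smul_one {T : E →L[ℝ] E} (hT : T.IsPositive) {lam : ℝ} (hlam : 0 < lam) :
    ∃ G Q : E →L[ℝ] E, G.adjoint = G ∧ Q.adjoint = Q ∧ G * G = T + lam • 1 ∧ Q * G = 1 ∧
      Q * Q = Ring.inverse (T + lam • 1) ∧ Q * T = T * Q ∧ ‖Q‖ ≤ 1 / √lam := by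
  have hpos : (T + lam • (1 : E →L[ℝ] E)).IsPositive :=
    hT.add (ContinuousLinearMap.isPositive_one.smul_of_nonneg hlam.le)
  obtain ⟨G, hG, hGG⟩ := exists_isPositive_mul_self _ hpos
  set U := Ring.inverse (T + lam • (1 : E →L[ℝ] E)) with hU
  have hu := isUnit_add_smul_one hT hlam
  have h1 : U * (G * G) = 1 := by rw [hGG]; exact Ring.inverse_mul_cancel _ hu
  have h2 : (G * G) * U = 1 := by rw [hGG]; exact Ring.mul_inverse_cancel _ hu
  -- `G` commutes with `G * G`, hence with its inverse `U`; therefore `U * G` is a two-sided,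
  -- self-adjoint inverse of `G` and serves as `Q`.
  have hGU : G * U = U * G := by
    calc G * U = (U * (G * G)) * (G * U) := by rw [h1, one_mul]
      _ = U * G * ((G * G) * U) := by noncomm_ring
      _ = U * G := by rw [h2, mul_one]
  have hGsa : star G = G := hG.isSelfAdjoint
  have hUsa : star U = U := by
    have h3 : (G * G) * star U = 1 := by
      have := congrArg star h1
      simpa [hGsa] using this
    calc star U = (U * (G * G)) * star U := by rw [h1, one_mul]
      _ = U * ((G * G) * star U) := by noncomm_ring
      _ = U := by rw [h3, mul_one]
  have hQG : (U * G) * G = 1 := by rw [mul_assoc, h1]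
  have hGQ : G * (U * G) = 1 := by rw [← hGU, ← mul_assoc, h2]
  have hT' : T = G * G - lam • 1 := by rw [hGG]; abel
  refine ⟨G, U * G, hGsa, ?_, hGG, hQG, ?_, ?_, ?_⟩
  · change star (U * G) = U * G
    rw [star_mul, hGsa, hUsa, hGU]
  · calc U * G * (U * G) = U * (G * (U * G)) := by noncomm_ring
      _ = U := by rw [hGQ, mul_one]
  · have h4 : (U * G) * (G * G) = (G * G) * (U * G) := by
      calc (U * G) * (G * G) = (U * (G * G)) * G := by noncomm_ring
        _ = ((G * G) * U) * G := by rw [h1, h2]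
        _ = _ := by noncomm_ring
    rw [hT', mul_sub, sub_mul, h4]
    simp
  · refine ContinuousLinearMap.opNorm_le_bound _ (by positivity) fun x => ?_
    set y := (U * G) x with hy
    have h5 : G y = x := by
      exact congrArg (fun S : E →L[ℝ] E => S x) hGQ
    have h6 : ‖x‖ ^ 2 = ⟪T y, y⟫ + lam * ‖y‖ ^ 2 := by
      rw [← real_inner_self_eq_norm_sq x, ← h5]
      have : ⟪G y, G y⟫ = ⟪(G * G) y, y⟫ := (hG.inner_left_eq_inner_right (G y) y).symm
      rw [this, hGG]
      simp [inner_add_left, inner_smul_left]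
    have h7 := hT.inner_nonneg_left y
    have h8 : (√lam * ‖y‖) ^ 2 ≤ ‖x‖ ^ 2 := by
      rw [mul_pow, Real.sq_sqrt hlam.le]
      linarith
    have h9 := (sq_le_sq₀ (by positivity) (norm_nonneg x)).1 h8
    have h10 : 0 < √lam := Real.sqrt_pos.2 hlam
    rw [one_div, le_inv_mul_iff₀ h10]
    exact h9

end Operators

/-! ### Consequences of the kernel assumptions -/

section Kernel

variable {X Y H : Type*} [NormedAddCommGroup Y] [InnerProductSpace ℝ Y] [CompleteSpace Y]
  [NormedAddCommGroup H] [InnerProductSpace ℝ H] [CompleteSpace H] [RKHS ℝ H X Y]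

theorem kappa_nonneg : 0 ≤ kappa H := Real.sqrt_nonneg _

theorem ofReal_kappa_sq (hK : kappaSq H < ⊤) : ENNReal.ofReal (kappa H ^ 2) = kappaSq H := by
  rw [kappa, Real.sq_sqrt ENNReal.toReal_nonneg, ENNReal.ofReal_toReal hK.ne]

/-- The reproducing property gives `‖K_x v‖² = ⟪v, (K_x v)(x)⟫ ≤ κ ‖v‖ ‖K_x v‖`; one factor cancels.
-/
theorem norm_kerFun_apply_le (hK : kappaSq H < ⊤) (x : X) (v : Y) :
    ‖RKHS.kerFun H x v‖ ≤ kappa H * ‖v‖ := by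
  by_contra! h
  have h0 : 0 < ‖RKHS.kerFun H x v‖ := lt_of_le_of_lt (mul_nonneg kappa_nonneg (norm_nonneg v)) h
  have h1 : ‖RKHS.kerFun H x v‖ ^ 2 ≤ ‖v‖ * ‖RKHS.kerFun H x v x‖ := by
    rw [← real_inner_self_eq_norm_sq, RKHS.kerFun_inner]
    exact real_inner_le_norm _ _
  have h2 := norm_eval_le hK (RKHS.kerFun H x v) x
  nlinarith [norm_nonneg v]

/-- `‖K_x* S‖²_HS = ∑ i, ‖(S eᵢ)(x)‖²` for an operator `S` of the kernel space. -/
def evalHSSq (S : H →L[ℝ] H) (x : X) : ℝ≥0∞ := hsNormSq ((RKHS.kerFun H x).adjoint ∘L S)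

theorem evalHSSq_eq_tsum (S : H →L[ℝ] H) (x : X) :
    evalHSSq S x = ∑' i, ‖S (stdBasis H i) x‖ₑ ^ 2 := by
  simp [evalHSSq, hsNormSq, RKHS.adjoint_kerFun]

theorem evalHSSq_le (hK : kappaSq H < ⊤) (S : H →L[ℝ] H) (x : X) :
    evalHSSq S x ≤ ENNReal.ofReal ((‖S‖ * kappa H) ^ 2) := by
  rw [evalHSSq, ← hsNormSq_adjoint, ContinuousLinearMap.adjoint_comp,
    ContinuousLinearMap.adjoint_adjoint]
  refine (hsNormSq_comp_le _ _).trans ?_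
  rw [mul_pow, ENNReal.ofReal_mul (by positivity), ofReal_kappa_sq hK,
    ENNReal.ofReal_pow (norm_nonneg _), ofReal_norm, LinearIsometryEquiv.enorm_map]
  gcongr
  exact le_iSup (fun x => hsNormSq (RKHS.kerFun H x)) x

theorem norm_adjoint_kerFun_apply_le (hK : kappaSq H < ⊤) (S : H →L[ℝ] H) (x : X) (v : Y) :
    ‖S.adjoint (RKHS.kerFun H x v)‖ ≤ √(evalHSSq S x).toReal * ‖v‖ := by
  have h := enorm_adjoint_apply_sq_le ((RKHS.kerFun H x).adjoint ∘L S) v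
  rw [ContinuousLinearMap.adjoint_comp, ContinuousLinearMap.adjoint_adjoint] at h
  have hfin : evalHSSq S x ≠ ⊤ := ((evalHSSq_le hK S x).trans_lt ENNReal.ofReal_lt_top).ne
  have h3 := ENNReal.toReal_mono (ENNReal.mul_ne_top hfin (by simp)) h
  rw [ENNReal.toReal_mul, ENNReal.toReal_pow, ENNReal.toReal_pow, toReal_enorm, toReal_enorm] at h3
  refine (sq_le_sq₀ (norm_nonneg _) (by positivity)).1 ?_
  rw [mul_pow, Real.sq_sqrt ENNReal.toReal_nonneg]
  exact h3

variable [MeasurableSpace X] [SecondCountableTopology Y] [MeasurableSpace Y] [BorelSpace Y]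

theorem measurable_evalHSSq [TopologicalSpace.SeparableSpace H] (hK : KernelAssumption H)
    (S : H →L[ℝ] H) : Measurable fun x : X => evalHSSq S x := by
  have := countable_stdBasisIndex H
  simp_rw [evalHSSq_eq_tsum]
  exact Measurable.tsum fun i => (measurable_apply hK _).enorm.pow_const 2

theorem IK_coeFn (hK : KernelAssumption H) (ν : Measure X) [IsFiniteMeasure ν] (f : H) :
    IK hK ν f =ᵐ[ν] fun x => f x :=
  (memLp_apply hK ν f).coeFn_toLp

theorem lintegral_enorm_apply_sq (hK : KernelAssumption H) (ν : Measure X) [IsFiniteMeasure ν]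
    (f : H) : ∫⁻ x, ‖f x‖ₑ ^ 2 ∂ν = ENNReal.ofReal (‖IK hK ν f‖ ^ 2) := by
  have h := Lp.enorm_def (IK hK ν f)
  rw [ENNReal.ofReal_pow (norm_nonneg _), ofReal_norm, h,
    eLpNorm_congr_ae (IK_coeFn hK ν f), eLpNorm_eq_lintegral_rpow_enorm_toReal (by simp) (by simp)]
  simp only [ENNReal.toReal_ofNat, ENNReal.rpow_ofNat]
  rw [← ENNReal.rpow_natCast, ← ENNReal.rpow_mul]
  simp

theorem LK_isPositive (hK : KernelAssumption H) (ν : Measure X) [IsFiniteMeasure ν] :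
    (LK hK ν).IsPositive :=
  ContinuousLinearMap.isPositive_adjoint_comp_self _

theorem inner_LK_self (hK : KernelAssumption H) (ν : Measure X) [IsFiniteMeasure ν] (f : H) :
    ⟪LK hK ν f, f⟫ = ‖IK hK ν f‖ ^ 2 := by
  rw [LK, ContinuousLinearMap.comp_apply, ContinuousLinearMap.adjoint_inner_left,
    real_inner_self_eq_norm_sq]

/-- As `Q` is self-adjoint and commutes with `L_K`, the trace of `Q² L_K` equals that of `Q L_K Q`,
whose diagonal entries are squares. -/
theorem effectiveDim_eq_tsum (hK : KernelAssumption H) (ν : Measure X) [IsFiniteMeasure ν]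
    {lam : ℝ} {Q : H →L[ℝ] H} (hQ : Q.adjoint = Q)
    (hQQ : Q * Q = Ring.inverse (LK hK ν + lam • 1)) (hQL : Q * LK hK ν = LK hK ν * Q) :
    effectiveDim hK ν lam = ∑' i, ‖IK hK ν (Q (stdBasis H i))‖ ^ 2 := by
  rw [effectiveDim, opTrace]
  congr 1
  funext i
  rw [← hQQ, ← inner_LK_self, mul_assoc, hQL]
  change ⟪Q (LK hK ν (Q _)), _⟫ = _
  nth_rw 1 [← hQ]
  rw [ContinuousLinearMap.adjoint_inner_left]

/-- Integrating over `x` term by term in the basis turns the sum of `‖(Q eᵢ)(x)‖²` into that of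
`‖I_K Q eᵢ‖²`. This is how the effective dimension enters the variance of the noise. -/
theorem lintegral_evalHSSq_eq_effectiveDim [TopologicalSpace.SeparableSpace H]
    (hK : KernelAssumption H) (ν : Measure X) [IsFiniteMeasure ν]
    {lam : ℝ} {Q : H →L[ℝ] H} (hQ : Q.adjoint = Q)
    (hQQ : Q * Q = Ring.inverse (LK hK ν + lam • 1)) (hQL : Q * LK hK ν = LK hK ν * Q) :
    ∫⁻ x, evalHSSq Q x ∂ν = ENNReal.ofReal (effectiveDim hK ν lam) := by
  have := countable_stdBasisIndex H
  -- Finiteness makes the real series summable, so that its `tsum` is not the default value zero.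
  have hfin : ∫⁻ x, evalHSSq Q x ∂ν ≠ ⊤ := by
    refine ((lintegral_mono fun x => evalHSSq_le hK.kappaSq_lt_top Q x).trans_lt ?_).ne
    rw [lintegral_const]
    exact ENNReal.mul_lt_top ENNReal.ofReal_lt_top (measure_lt_top _ _)
  have h1 : ∫⁻ x, evalHSSq Q x ∂ν = ∑' i, ENNReal.ofReal (‖IK hK ν (Q (stdBasis H i))‖ ^ 2) := by
    simp_rw [evalHSSq_eq_tsum]
    rw [lintegral_tsum fun i => ((measurable_apply hK _).enorm.pow_const 2).aemeasurable]
    simp_rw [lintegral_enorm_apply_sq hK]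
  rw [h1] at hfin ⊢
  rw [effectiveDim_eq_tsum hK ν hQ hQQ hQL, ENNReal.ofReal_tsum_of_nonneg (fun i => by positivity)]
  have := ENNReal.summable_toReal hfin
  simpa [ENNReal.toReal_ofReal] using this

end Kernel

/-! ### Concentration of the noise term -/

section CondKernel

variable {X Y : Type*} [MeasurableSpace X] [MeasurableSpace Y] [StandardBorelSpace Y] [Nonempty Y]
  {ρ : Measure (X × Y)} [IsFiniteMeasure ρ]

theorem lintegral_fst_mul_le {f : X → ℝ≥0∞} (hf : Measurable f) {u : X × Y → ℝ≥0∞}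
    (hu : Measurable u) {c : ℝ≥0∞} (h : ∀ᵐ x ∂ρ.fst, ∫⁻ y, u (x, y) ∂(ρ.condKernel x) ≤ c) :
    ∫⁻ p, f p.1 * u p ∂ρ ≤ (∫⁻ x, f x ∂ρ.fst) * c := by
  have hmul : Measurable fun p : X × Y => f p.1 * u p := (hf.comp measurable_fst).mul hu
  rw [← Measure.lintegral_condKernel hmul, ← lintegral_mul_const _ hf]
  refine lintegral_mono_ae ?_
  filter_upwards [h] with x hx
  have hux : Measurable fun y : Y => u (x, y) := hu.comp measurable_prodMk_left
  rw [lintegral_const_mul _ hux]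
  gcongr

end CondKernel

section Noise

variable {X Y H : Type*} [MeasurableSpace X]
  [NormedAddCommGroup Y] [InnerProductSpace ℝ Y] [CompleteSpace Y] [SecondCountableTopology Y]
  [MeasurableSpace Y] [BorelSpace Y]
  [NormedAddCommGroup H] [InnerProductSpace ℝ H] [CompleteSpace H]
  [TopologicalSpace.SeparableSpace H] [RKHS ℝ H X Y]

/-- The random vector `S* K_x (y - h(x))`. -/
def noiseVec (h : H) (S : H →L[ℝ] H) (p : X × Y) : H :=
  S.adjoint (RKHS.kerFun H p.1 (p.2 - h p.1))

omit [MeasurableSpace X] [SecondCountableTopology Y] [MeasurableSpace Y] [BorelSpace Y]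
  [TopologicalSpace.SeparableSpace H] in
theorem inner_noiseVec (h v : H) (S : H →L[ℝ] H) (p : X × Y) :
    ⟪v, noiseVec h S p⟫ = ⟪S v p.1, p.2 - h p.1⟫ := by
  rw [noiseVec, ContinuousLinearMap.adjoint_inner_right, RKHS.inner_kerFun]

omit [TopologicalSpace.SeparableSpace H] in
theorem measurable_residual (hK : KernelAssumption H) (h : H) :
    Measurable fun p : X × Y => p.2 - h p.1 :=
  measurable_snd.sub ((measurable_apply hK h).comp measurable_fst)

theorem stronglyMeasurable_noiseVec (hK : KernelAssumption H) (h : H) (S : H →L[ℝ] H) :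
    StronglyMeasurable (noiseVec h S : X × Y → H) := by
  have := countable_stdBasisIndex H
  refine stronglyMeasurable_of_inner (stdBasis H) fun i => ?_
  simp_rw [inner_noiseVec]
  exact ((measurable_apply hK _).comp measurable_fst).inner (measurable_residual hK h)

variable {ρ : Measure (X × Y)} [IsProbabilityMeasure ρ]

omit [TopologicalSpace.SeparableSpace H] in
-- The noise condition controls `expRem`, and `t ≤ 1 + t² / 2 ≤ 1 + expRem t` for `t ≥ 0`.
theorem integrable_norm_residual (hK : KernelAssumption H) {h : H} {M Sig : ℝ} (hM : 0 < M)
    (hnoise : ∀ᵐ x ∂ρ.fst, ∫⁻ y, ENNReal.ofReal (expRem (‖y - h x‖ / M)) ∂(ρ.condKernel x)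
      ≤ ENNReal.ofReal (Sig ^ 2 / (2 * M ^ 2))) :
    Integrable (fun p : X × Y => ‖p.2 - h p.1‖) ρ := by
  have hm : Measurable fun p : X × Y => expRem (‖p.2 - h p.1‖ / M) :=
    continuous_expRem.measurable.comp ((measurable_residual hK h).norm.div_const M)
  have hi : Integrable (fun p : X × Y => expRem (‖p.2 - h p.1‖ / M)) ρ := by
    refine (lintegral_ofReal_ne_top_iff_integrable hm.aestronglyMeasurable
      (Eventually.of_forall fun ω => expRem_nonneg _)).1 ?_
    rw [← Measure.lintegral_condKernel hm.ennreal_ofReal]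
    refine ((lintegral_mono_ae hnoise).trans_lt ?_).ne
    simp
  refine (((integrable_const 1).add hi).const_mul M).mono'
    (measurable_residual hK h).norm.aestronglyMeasurable (Eventually.of_forall fun p => ?_)
  rw [norm_norm]
  have h1 := sq_div_two_le_expRem (t := ‖p.2 - h p.1‖ / M) (by positivity)
  have h2 : ‖p.2 - h p.1‖ / M ≤ 1 + expRem (‖p.2 - h p.1‖ / M) := by
    nlinarith [sq_nonneg (‖p.2 - h p.1‖ / M - 1)]
  rw [div_le_iff₀ hM] at h2
  simp only [Pi.add_apply]
  linarith

omit [TopologicalSpace.SeparableSpace H] [IsProbabilityMeasure ρ] in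
theorem integrable_inner_noiseVec (hK : KernelAssumption H) {h : H}
    (hint : Integrable (fun p : X × Y => ‖p.2 - h p.1‖) ρ) (S : H →L[ℝ] H) (v : H) :
    Integrable (fun p => ⟪v, noiseVec h S p⟫) ρ := by
  simp_rw [inner_noiseVec]
  refine (hint.const_mul (kappa H * ‖S v‖)).mono'
    (((measurable_apply hK _).comp measurable_fst).inner
      (measurable_residual hK h)).aestronglyMeasurable (Eventually.of_forall fun p => ?_)
  refine (norm_inner_le_norm _ _).trans ?_
  gcongr
  exact norm_eval_le hK.kappaSq_lt_top _ _

omit [TopologicalSpace.SeparableSpace H] in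
theorem integral_inner_noiseVec (hK : KernelAssumption H) {h : H}
    (hint : Integrable (fun p : X × Y => ‖p.2 - h p.1‖) ρ)
    (hi : ∀ᵐ x ∂ρ.fst, Integrable (fun y : Y => y) (ρ.condKernel x))
    (hmean : ∀ᵐ x ∂ρ.fst, ∫ y, y ∂(ρ.condKernel x) = h x) (S : H →L[ℝ] H) (v : H) :
    ∫ p, ⟪v, noiseVec h S p⟫ ∂ρ = 0 := by
  rw [← Measure.integral_condKernel (integrable_inner_noiseVec hK hint S v)]
  refine integral_eq_zero_of_ae ?_
  filter_upwards [hi, hmean] with x hx1 hx2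
  simp_rw [inner_noiseVec]
  have hx3 : Integrable (fun y : Y => y - h x) (ρ.condKernel x) := hx1.sub (integrable_const _)
  rw [integral_inner hx3, integral_sub hx1 (integrable_const _), hx2]
  simp

omit [MeasurableSpace X] [SecondCountableTopology Y] [MeasurableSpace Y] [BorelSpace Y]
  [TopologicalSpace.SeparableSpace H] in
-- Normalizing by the uniform bound `s` leaves a ratio `q / s ≤ 1`, which `expRem_mul_le` pulls out
-- squared. The pointwise `evalHSSq S x` thus survives and can be integrated, instead of being
-- replaced by its supremum.
theorem expRem_noiseVec_le (hK : kappaSq H < ⊤) (h : H) {M : ℝ} (hM : 0 < M)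
    {S : H →L[ℝ] H} {s : ℝ} (hs : 0 < s) (hSs : ‖S‖ * kappa H ≤ s) (p : X × Y) :
    ENNReal.ofReal (expRem (‖noiseVec h S p‖ / (s * M))) ≤
      evalHSSq S p.1 * ENNReal.ofReal (1 / s ^ 2) *
        ENNReal.ofReal (expRem (‖p.2 - h p.1‖ / M)) := by
  have hfin : evalHSSq S p.1 ≤ ENNReal.ofReal (s ^ 2) :=
    (evalHSSq_le hK S p.1).trans (ENNReal.ofReal_le_ofReal
      (pow_le_pow_left₀ (mul_nonneg (norm_nonneg _) kappa_nonneg) hSs 2))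
  set q := √(evalHSSq S p.1).toReal with hq
  have hq2 : q ^ 2 = (evalHSSq S p.1).toReal := Real.sq_sqrt ENNReal.toReal_nonneg
  have hq0 : 0 ≤ q := Real.sqrt_nonneg _
  have hqs : q ≤ s := by
    refine (sq_le_sq₀ hq0 hs.le).1 ?_
    rw [hq2]
    exact ENNReal.toReal_le_of_le_ofReal (by positivity) hfin
  have h1 : evalHSSq S p.1 * ENNReal.ofReal (1 / s ^ 2) = ENNReal.ofReal ((q / s) ^ 2) := by
    rw [div_pow, div_eq_mul_one_div (q ^ 2), ENNReal.ofReal_mul (by positivity), hq2,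
      ENNReal.ofReal_toReal (hfin.trans_lt ENNReal.ofReal_lt_top).ne]
  rw [h1, ← ENNReal.ofReal_mul (by positivity)]
  refine ENNReal.ofReal_le_ofReal (le_trans (expRem_mono (by positivity) ?_)
    (expRem_mul_le (by positivity) ((div_le_one hs).2 hqs) (by positivity)))
  rw [div_mul_div_comm]
  gcongr
  exact norm_adjoint_kerFun_apply_le hK S p.1 _

theorem lintegral_expRem_noiseVec_le (hK : KernelAssumption H) {h : H} {M Sig : ℝ} (hM : 0 < M)
    (hnoise : ∀ᵐ x ∂ρ.fst, ∫⁻ y, ENNReal.ofReal (expRem (‖y - h x‖ / M)) ∂(ρ.condKernel x)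
      ≤ ENNReal.ofReal (Sig ^ 2 / (2 * M ^ 2)))
    {S : H →L[ℝ] H} {s N : ℝ} (hs : 0 < s) (hSs : ‖S‖ * kappa H ≤ s) (hN : 0 ≤ N)
    (hSN : ∫⁻ x, evalHSSq S x ∂ρ.fst ≤ ENNReal.ofReal N) :
    ∫⁻ p, ENNReal.ofReal (expRem (‖noiseVec h S p‖ / (s * M))) ∂ρ ≤
      ENNReal.ofReal ((√N * Sig) ^ 2 / (2 * (s * M) ^ 2)) := by
  have hme : Measurable fun p : X × Y => ENNReal.ofReal (expRem (‖p.2 - h p.1‖ / M)) :=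
    (continuous_expRem.measurable.comp
      ((measurable_residual hK h).norm.div_const M)).ennreal_ofReal
  have hmS : Measurable fun x => evalHSSq S x := measurable_evalHSSq hK S
  have hmq : Measurable fun x => evalHSSq S x * ENNReal.ofReal (1 / s ^ 2) := hmS.mul_const _
  calc ∫⁻ p, ENNReal.ofReal (expRem (‖noiseVec h S p‖ / (s * M))) ∂ρ
      ≤ ∫⁻ p, evalHSSq S p.1 * ENNReal.ofReal (1 / s ^ 2) *
        ENNReal.ofReal (expRem (‖p.2 - h p.1‖ / M)) ∂ρ :=
        lintegral_mono (expRem_noiseVec_le hK.kappaSq_lt_top h hM hs hSs)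
    _ ≤ (∫⁻ x, evalHSSq S x * ENNReal.ofReal (1 / s ^ 2) ∂ρ.fst) *
        ENNReal.ofReal (Sig ^ 2 / (2 * M ^ 2)) := lintegral_fst_mul_le hmq hme hnoise
    _ = (∫⁻ x, evalHSSq S x ∂ρ.fst) * ENNReal.ofReal (1 / s ^ 2) *
        ENNReal.ofReal (Sig ^ 2 / (2 * M ^ 2)) := by
        rw [lintegral_mul_const _ hmS]
    _ ≤ ENNReal.ofReal N * ENNReal.ofReal (1 / s ^ 2) *
        ENNReal.ofReal (Sig ^ 2 / (2 * M ^ 2)) := by gcongr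
    _ = _ := by
        rw [← ENNReal.ofReal_mul hN, ← ENNReal.ofReal_mul (by positivity)]
        congr 1
        rw [mul_pow, Real.sq_sqrt hN]
        field_simp

/-- Concentration of the sum of the vectors `S* K_x (y - h(x))` over a sample. -/
theorem measure_norm_sum_noiseVec_ge_le (hK : KernelAssumption H) {h : H} {M Sig : ℝ}
    (hM : 0 < M) (hSig : 0 < Sig)
    (hi : ∀ᵐ x ∂ρ.fst, Integrable (fun y : Y => y) (ρ.condKernel x))
    (hmean : ∀ᵐ x ∂ρ.fst, ∫ y, y ∂(ρ.condKernel x) = h x)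
    (hnoise : ∀ᵐ x ∂ρ.fst, ∫⁻ y, ENNReal.ofReal (expRem (‖y - h x‖ / M)) ∂(ρ.condKernel x)
      ≤ ENNReal.ofReal (Sig ^ 2 / (2 * M ^ 2)))
    {S : H →L[ℝ] H} {s N : ℝ} (hs : 0 < s) (hSs : ‖S‖ * kappa H ≤ s) (hN : 0 ≤ N)
    (hSN : ∫⁻ x, evalHSSq S x ∂ρ.fst ≤ ENNReal.ofReal N) (m : ℕ) (l : ℝ) :
    Measure.pi (fun _ : Fin m => ρ)
      {z | 2 * (s * M + √N * Sig * √m) * l ≤ ‖∑ i, noiseVec h S (z i)‖} ≤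
      ENNReal.ofReal (2 * Real.exp (1 / 2) * Real.exp (-(2 * l))) := by
  have hint := integrable_norm_residual hK hM hnoise
  exact measure_norm_sum_ge_le (stronglyMeasurable_noiseVec hK h S)
    (integrable_inner_noiseVec hK hint S) (integral_inner_noiseVec hK hint hi hmean S)
    (by positivity) (by positivity) (lintegral_expRem_noiseVec_le hK hM hnoise hs hSs hN hSN) m l

end Noise

/-! ### Concentration of the empirical covariance operator -/

section Covariance

variable {X Y H : Type*}
  [NormedAddCommGroup Y] [InnerProductSpace ℝ Y] [CompleteSpace Y]
  [NormedAddCommGroup H] [InnerProductSpace ℝ H] [CompleteSpace H] [RKHS ℝ H X Y]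

theorem summable_norm_stdBasis_apply_sq (hK : kappaSq H < ⊤) (x : X) :
    Summable (fun i => ‖stdBasis H i x‖ ^ 2) ∧ ∑' i, ‖stdBasis H i x‖ ^ 2 ≤ kappa H ^ 2 := by
  have h1 : ∑' i, ENNReal.ofReal (‖stdBasis H i x‖ ^ 2) ≤ ENNReal.ofReal (kappa H ^ 2) := by
    have h2 := evalHSSq_eq_tsum (ContinuousLinearMap.id ℝ H) x
    simp only [ContinuousLinearMap.coe_id', id_eq] at h2
    simp_rw [ENNReal.ofReal_pow (norm_nonneg _), ofReal_norm]
    rw [← h2]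
    refine (evalHSSq_le hK _ x).trans (ENNReal.ofReal_le_ofReal ?_)
    have := kappa_nonneg (H := H)
    gcongr
    exact mul_le_of_le_one_left this ContinuousLinearMap.norm_id_le
  have h3 : Summable (fun i => ‖stdBasis H i x‖ ^ 2) := by
    have := ENNReal.summable_toReal (h1.trans_lt ENNReal.ofReal_lt_top).ne
    simpa [ENNReal.toReal_ofReal] using this
  refine ⟨h3, ?_⟩
  rw [← ENNReal.ofReal_tsum_of_nonneg (fun i => by positivity) h3] at h1
  exact (ENNReal.ofReal_le_ofReal_iff (by positivity)).1 h1

theorem summable_norm_kerFun_stdBasis_sq (hK : kappaSq H < ⊤) (x : X) :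
    Summable (fun i => ‖RKHS.kerFun H x (stdBasis H i x)‖ ^ 2) ∧
      ∑' i, ‖RKHS.kerFun H x (stdBasis H i x)‖ ^ 2 ≤ (kappa H ^ 2) ^ 2 := by
  obtain ⟨h1, h2⟩ := summable_norm_stdBasis_apply_sq (H := H) hK x
  have h3 : ∀ i, ‖RKHS.kerFun H x (stdBasis H i x)‖ ^ 2 ≤ kappa H ^ 2 * ‖stdBasis H i x‖ ^ 2 := by
    intro i
    rw [← mul_pow]
    gcongr
    exact norm_kerFun_apply_le hK x _
  have h4 := Summable.of_nonneg_of_le (fun i => by positivity) h3 (h1.mul_left _)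
  refine ⟨h4, (h4.tsum_le_tsum h3 (h1.mul_left _)).trans ?_⟩
  rw [tsum_mul_left, sq (kappa H ^ 2)]
  gcongr

/-- The operator `K_x K_x*` as an element of the Hilbert space of Hilbert-Schmidt operators, given
by its values on a Hilbert basis. -/
def covVec (hK : kappaSq H < ⊤) (x : X) : lp (fun _ : stdBasisIndex H => H) 2 :=
  ⟨fun i => RKHS.kerFun H x (stdBasis H i x), memℓp_gen (by
    simpa using (summable_norm_kerFun_stdBasis_sq hK x).1)⟩

/-- The rank one operator `u ↦ ⟪u, f⟫ f`, given by its values on a Hilbert basis. -/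
def rankOneVec (f : H) : lp (fun _ : stdBasisIndex H => H) 2 :=
  ⟨fun i => ⟪stdBasis H i, f⟫ • f, memℓp_gen (by
    have h := ((stdBasis H).hasSum_inner_mul_inner f f).summable.mul_right (‖f‖ ^ 2)
    refine h.congr fun i => ?_
    simp only [ENNReal.toReal_ofNat, Real.rpow_ofNat, norm_smul, mul_pow, Real.norm_eq_abs, sq_abs]
    rw [real_inner_comm (stdBasis H i) f]
    ring)⟩

theorem norm_covVec_le (hK : kappaSq H < ⊤) (x : X) : ‖covVec hK x‖ ≤ kappa H ^ 2 := by
  refine (sq_le_sq₀ (norm_nonneg _) (by positivity)).1 ?_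
  rw [← real_inner_self_eq_norm_sq, lp.inner_eq_tsum]
  simp_rw [real_inner_self_eq_norm_sq]
  exact (summable_norm_kerFun_stdBasis_sq hK x).2

omit [RKHS ℝ H X Y] in
theorem norm_rankOneVec (f : H) : ‖rankOneVec f‖ = ‖f‖ ^ 2 := by
  refine (sq_eq_sq₀ (norm_nonneg _) (by positivity)).1 ?_
  rw [← real_inner_self_eq_norm_sq, lp.inner_eq_tsum]
  have h := (((stdBasis H).hasSum_inner_mul_inner f f).mul_right (‖f‖ ^ 2)).tsum_eq
  rw [real_inner_self_eq_norm_sq, ← sq] at h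
  rw [← h]
  congr 1
  funext i
  change ⟪⟪stdBasis H i, f⟫ • f, ⟪stdBasis H i, f⟫ • f⟫ = _
  rw [inner_smul_left, inner_smul_right, real_inner_self_eq_norm_sq,
    real_inner_comm (stdBasis H i) f]
  simp
  ring

/-- The quadratic form `⟪K_x K_x* f, f⟫` becomes a Hilbert–Schmidt pairing, so a single norm bound
on the centered sum controls all `f` at once. -/
theorem inner_rankOneVec_covVec (hK : kappaSq H < ⊤) (f : H) (x : X) :
    ⟪rankOneVec f, covVec hK x⟫ = ‖f x‖ ^ 2 := by
  rw [lp.inner_eq_tsum]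
  have h := ((stdBasis H).hasSum_inner_mul_inner f (RKHS.kerFun H x (f x))).tsum_eq
  rw [RKHS.inner_kerFun, real_inner_self_eq_norm_sq] at h
  rw [← h]
  congr 1
  funext i
  change ⟪⟪stdBasis H i, f⟫ • f, RKHS.kerFun H x (stdBasis H i x)⟫ = _
  rw [inner_smul_left, RKHS.inner_kerFun, RKHS.inner_kerFun, real_inner_comm (stdBasis H i) f,
    real_inner_comm (stdBasis H i x) (f x)]
  simp

variable [MeasurableSpace X] [SecondCountableTopology Y] [MeasurableSpace Y] [BorelSpace Y]
  [TopologicalSpace.SeparableSpace H]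

theorem stronglyMeasurable_covVec (hK : KernelAssumption H) :
    StronglyMeasurable (covVec hK.kappaSq_lt_top : X → lp (fun _ : stdBasisIndex H => H) 2) := by
  classical
  have := countable_stdBasisIndex H
  refine stronglyMeasurable_of_tendsto (atTop : Filter (Finset (stdBasisIndex H)))
    (f := fun s x => ∑ i ∈ s, lp.single 2 i (covVec hK.kappaSq_lt_top x i)) (fun s => ?_) ?_
  · refine Finset.stronglyMeasurable_fun_sum _ fun i _ => ?_
    refine (lp.isometry_single (E := fun _ : stdBasisIndex H => H) (p := 2)
      i).continuous.comp_stronglyMeasurable ?_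
    refine stronglyMeasurable_of_inner (stdBasis H) fun j => ?_
    change Measurable fun x => ⟪stdBasis H j, RKHS.kerFun H x (stdBasis H i x)⟫
    simp_rw [RKHS.inner_kerFun]
    exact (measurable_apply hK _).inner (measurable_apply hK _)
  · rw [tendsto_pi_nhds]
    exact fun x => lp.hasSum_single (by simp) (covVec hK.kappaSq_lt_top x)

variable (ρ : Measure (X × Y)) [IsProbabilityMeasure ρ]

theorem integrable_covVec (hK : KernelAssumption H) :
    Integrable (fun p : X × Y => covVec hK.kappaSq_lt_top p.1) ρ :=
  Integrable.of_bound
    ((stronglyMeasurable_covVec hK).comp_measurable measurable_fst).aestronglyMeasurable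
    (kappa H ^ 2) (Eventually.of_forall fun _ => norm_covVec_le _ _)

/-- The operator `K_x K_x*`, centered at its mean `L_K`. -/
def centeredCovVec (hK : KernelAssumption H) (p : X × Y) :
    lp (fun _ : stdBasisIndex H => H) 2 :=
  covVec hK.kappaSq_lt_top p.1 - ∫ q : X × Y, covVec hK.kappaSq_lt_top q.1 ∂ρ

omit [IsProbabilityMeasure ρ] in
theorem stronglyMeasurable_centeredCovVec (hK : KernelAssumption H) :
    StronglyMeasurable (centeredCovVec ρ hK) :=
  ((stronglyMeasurable_covVec hK).comp_measurable measurable_fst).sub stronglyMeasurable_const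

theorem measure_norm_sum_centeredCovVec_ge_le (hK : KernelAssumption H) (hκ : 0 < kappa H)
    (m : ℕ) (l : ℝ) :
    Measure.pi (fun _ : Fin m => ρ)
      {z | 2 * (2 * kappa H ^ 2 + 4 * kappa H ^ 2 * √m) * l ≤ ‖∑ i, centeredCovVec ρ hK (z i)‖} ≤
      ENNReal.ofReal (2 * Real.exp (1 / 2) * Real.exp (-(2 * l))) := by
  have hi := integrable_covVec ρ hK
  have hci : Integrable (centeredCovVec ρ hK) ρ := hi.sub (integrable_const _)
  refine measure_norm_sum_ge_le (stronglyMeasurable_centeredCovVec ρ hK)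
    (fun v => hci.const_inner v) (fun v => ?_) (by positivity) (by positivity) ?_ m l
  · rw [integral_inner hci]
    have : ∫ p, centeredCovVec ρ hK p ∂ρ = 0 := by
      simp only [centeredCovVec]
      rw [integral_sub hi (integrable_const _)]
      simp
    rw [this, inner_zero_right]
  -- With range `2κ²` the integrand is at most `expRem 1 = e - 2 < 1`, while the choice `S = 4κ²`
  -- makes the allowed right side equal to 2.
  · calc _ ≤ ∫⁻ _ : X × Y, ENNReal.ofReal 1 ∂ρ := by
          refine lintegral_mono fun p => ENNReal.ofReal_le_ofReal ?_
          have h1 : ‖centeredCovVec ρ hK p‖ ≤ 2 * kappa H ^ 2 := by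
            refine (norm_sub_le _ _).trans ?_
            have h2 := norm_integral_le_of_norm_le_const (μ := ρ)
              (Eventually.of_forall fun q : X × Y => norm_covVec_le hK.kappaSq_lt_top q.1)
            simp only [probReal_univ, mul_one] at h2
            linarith [norm_covVec_le hK.kappaSq_lt_top p.1]
          refine (expRem_mono (by positivity) ((div_le_one (by positivity)).2 h1)).trans ?_
          have := Real.exp_one_lt_d9
          unfold expRem
          linarith
      _ ≤ _ := by
          rw [lintegral_const, measure_univ, mul_one]
          refine ENNReal.ofReal_le_ofReal ?_
          rw [le_div_iff₀ (by positivity)]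
          nlinarith [sq_nonneg (kappa H ^ 2)]

/-- Cauchy–Schwarz for the centered sum against `rankOneVec f`, whose norm is `‖f‖²`. -/
theorem le_sum_norm_apply_sq (hK : KernelAssumption H) {m : ℕ} (z : Fin m → X × Y) {r : ℝ}
    (hr : ‖∑ i, centeredCovVec ρ hK (z i)‖ ≤ r) (f : H) :
    m * ‖IK hK ρ.fst f‖ ^ 2 - r * ‖f‖ ^ 2 ≤ ∑ i, ‖f (z i).1‖ ^ 2 := by
  have hi := integrable_covVec ρ hK
  have hmean : ⟪rankOneVec f, ∫ q : X × Y, covVec hK.kappaSq_lt_top q.1 ∂ρ⟫ =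
      ‖IK hK ρ.fst f‖ ^ 2 := by
    rw [← integral_inner hi]
    simp_rw [inner_rankOneVec_covVec]
    have h1 := lintegral_enorm_apply_sq hK ρ.fst f
    change ∫⁻ x, ‖f x‖ₑ ^ 2 ∂(ρ.map Prod.fst) = _ at h1
    rw [lintegral_map ((measurable_apply hK f).enorm.pow_const 2) measurable_fst] at h1
    have hm : Measurable fun p : X × Y => ‖f p.1‖ ^ 2 :=
      ((measurable_apply hK f).comp measurable_fst).norm.pow_const 2
    rw [integral_eq_lintegral_of_nonneg_ae (Eventually.of_forall fun p => by positivity)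
      hm.aestronglyMeasurable]
    simp_rw [ENNReal.ofReal_pow (norm_nonneg _), ofReal_norm]
    rw [h1, ENNReal.toReal_ofReal (by positivity)]
  have h2 : ⟪rankOneVec f, ∑ i, centeredCovVec ρ hK (z i)⟫ =
      ∑ i, ‖f (z i).1‖ ^ 2 - m * ‖IK hK ρ.fst f‖ ^ 2 := by
    simp_rw [inner_sum, centeredCovVec, inner_sub_right, hmean, inner_rankOneVec_covVec]
    simp [Finset.sum_sub_distrib]
  have h3 := (abs_le.1 (abs_real_inner_le_norm (rankOneVec f)
    (∑ i, centeredCovVec ρ hK (z i)))).1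
  rw [h2, norm_rankOneVec] at h3
  nlinarith [mul_le_mul_of_nonneg_left hr (sq_nonneg ‖f‖)]

end Covariance

/-! ### Error bounds for a fixed sample -/

section Deterministic

/-- Multiplying `h` by `k = 6 L² + 1` enlarges the penalty until half of it pays for the defect
`(3/2) L² v²`, while `q ≤ k q` keeps the lower bound by `a²`. Young's inequality then absorbs the
terms linear in `a` and `v`. -/
theorem bounds_of_quadratic_inequality {q a v W L : ℝ} (hq : 0 ≤ q)
    (hW : 0 ≤ W) (hqa : a ^ 2 - 3 / 2 * (L ^ 2 * v ^ 2) ≤ q)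
    (h : q + v ^ 2 / 2 ≤ 2 * W * (a + L * v)) :
    a ≤ 3 * (6 * L ^ 2 + 1) * W ∧ v ≤ 6 * (6 * L ^ 2 + 1) * W := by
  set k : ℝ := 6 * L ^ 2 + 1 with hk
  have hk1 : 1 ≤ k := by nlinarith [sq_nonneg L]
  have h1 : a ^ 2 + k * v ^ 2 / 4 ≤ 2 * k * W * (a + L * v) := by
    have h2 : a ^ 2 - 3 / 2 * (L ^ 2 * v ^ 2) ≤ k * q := by nlinarith
    have h3 := mul_le_mul_of_nonneg_left h (by linarith : (0 : ℝ) ≤ k)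
    have h4 : 3 / 2 * (L ^ 2 * v ^ 2) ≤ k * v ^ 2 / 4 := by
      rw [hk]; nlinarith [sq_nonneg v]
    nlinarith
  have h5 : 2 * k * W * a ≤ a ^ 2 / 2 + 2 * (k * W) ^ 2 := by
    nlinarith [sq_nonneg (a - 2 * (k * W))]
  have h6 : 2 * k * W * (L * v) ≤ k * v ^ 2 / 8 + 8 * k * L ^ 2 * W ^ 2 := by
    have : 0 ≤ k / 8 * (v - 8 * (L * W)) ^ 2 := by positivity
    nlinarith
  have h7 : 8 * k * L ^ 2 * W ^ 2 ≤ 2 * (k * W) ^ 2 := by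
    have : 0 ≤ k * W ^ 2 := by positivity
    have h8 : 8 * L ^ 2 ≤ 2 * k := by rw [hk]; nlinarith [sq_nonneg L]
    nlinarith [mul_le_mul_of_nonneg_left h8 this]
  have h9 : a ^ 2 / 2 + k * v ^ 2 / 8 ≤ 4 * (k * W) ^ 2 := by nlinarith
  have hkW : 0 ≤ k * W := by positivity
  constructor
  · have : a ^ 2 ≤ (3 * k * W) ^ 2 := by
      have : 0 ≤ k * v ^ 2 / 8 := by positivity
      nlinarith
    exact abs_le_of_sq_le_sq' this (by positivity) |>.2
  · have : v ^ 2 ≤ (6 * k * W) ^ 2 := by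
      have : v ^ 2 ≤ k * v ^ 2 := by nlinarith [sq_nonneg v]
      nlinarith [sq_nonneg a]
    exact abs_le_of_sq_le_sq' this (by positivity) |>.2

/-- Both squared norms equal `⟪B* B v, v⟫`. It lets the source condition be tested through `B`. -/
theorem norm_opSqrt_adjoint_comp_self_apply {E F : Type*} [NormedAddCommGroup E]
    [InnerProductSpace ℝ E] [CompleteSpace E] [NormedAddCommGroup F] [InnerProductSpace ℝ F]
    [CompleteSpace F] (B : E →L[ℝ] F) (hB : (B.adjoint ∘L B).IsPositive) (v : E) :
    ‖opSqrt (B.adjoint ∘L B) hB v‖ = ‖B v‖ := by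
  refine (sq_eq_sq₀ (norm_nonneg _) (norm_nonneg _)).1 ?_
  rw [← real_inner_self_eq_norm_sq,
    ← (opSqrt_isPositive (B.adjoint ∘L B) hB).inner_left_eq_inner_right]
  change ⟪(opSqrt _ hB * opSqrt _ hB) v, v⟫ = _
  rw [opSqrt_mul_self, ContinuousLinearMap.comp_apply, ContinuousLinearMap.adjoint_inner_left,
    real_inner_self_eq_norm_sq]

variable {X Y H₁ H₂ : Type*}
  [NormedAddCommGroup Y] [InnerProductSpace ℝ Y] [CompleteSpace Y]
  [NormedAddCommGroup H₁] [InnerProductSpace ℝ H₁]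
  [NormedAddCommGroup H₂] [InnerProductSpace ℝ H₂] [CompleteSpace H₂] [RKHS ℝ H₂ X Y]

/-- The inequality obtained by comparing the values of the Tikhonov functional at an estimator
and at the true solution. -/
theorem IsTikhonovEstimator.basic_inequality {D : Set H₁} {A : H₁ → H₂} {fbar f₀ f : H₁}
    {lam : ℝ} {m : ℕ} {z : Fin m → X × Y} (hf : IsTikhonovEstimator D A fbar lam z f)
    (hf₀ : f₀ ∈ D) :
    1 / (m : ℝ) * ∑ i, ‖(A f - A f₀) (z i).1‖ ^ 2 + lam * ‖f - f₀‖ ^ 2 ≤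
      2 / m * ⟪A f - A f₀, ∑ i, noiseVec (A f₀) (ContinuousLinearMap.id ℝ H₂) (z i)⟫ +
        2 * lam * ⟪f₀ - fbar, f₀ - f⟫ := by
  have h := hf.2 f₀ hf₀
  unfold tikhonov at h
  have h1 : ∀ i, ‖A f (z i).1 - (z i).2‖ ^ 2 = ‖(A f - A f₀) (z i).1‖ ^ 2
      - 2 * ⟪A f - A f₀, noiseVec (A f₀) (ContinuousLinearMap.id ℝ H₂) (z i)⟫
      + ‖A f₀ (z i).1 - (z i).2‖ ^ 2 := by
    intro i
    rw [inner_noiseVec, ContinuousLinearMap.id_apply,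
      norm_sub_rev (A f₀ (z i).1), ← norm_sub_sq_real]
    congr 2
    simp
  have h2 : ‖f - fbar‖ ^ 2 = ‖f - f₀‖ ^ 2 - 2 * ⟪f₀ - fbar, f₀ - f⟫ + ‖f₀ - fbar‖ ^ 2 := by
    rw [norm_sub_rev f f₀, real_inner_comm, ← norm_sub_sq_real, ← norm_neg]
    congr 2
    abel
  simp_rw [h1] at h
  rw [Finset.sum_add_distrib, Finset.sum_sub_distrib, ← Finset.mul_sum, ← inner_sum, h2] at h
  rw [div_eq_mul_one_div 2 (m : ℝ)]
  linarith

/-- A minimizer lies in the ball around the true solution. -/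
theorem IsTikhonovEstimator.norm_sub_lt {D : Set H₁} {A : H₁ → H₂} {fbar f₀ f : H₁}
    {lam d L : ℝ} {m : ℕ} {z : Fin m → X × Y} (hf : IsTikhonovEstimator D A fbar lam z f)
    (hf₀ : f₀ ∈ D) (hlam : 0 < lam) (hm : 0 < m) (hL : ‖A f - A f₀‖ ≤ L * ‖f - f₀‖)
    (hd : 4 * ‖f₀ - fbar‖ < d)
    (hs : 4 * L * ‖∑ i, noiseVec (A f₀) (ContinuousLinearMap.id ℝ H₂) (z i)‖ ≤ m * lam * d) :
    ‖f - f₀‖ < d := by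
  have hb := hf.basic_inequality hf₀
  set s := ∑ i, noiseVec (A f₀) (ContinuousLinearMap.id ℝ H₂) (z i)
  set e := ‖f - f₀‖ with he
  have hm' : (0 : ℝ) < m := by exact_mod_cast hm
  have he0 : 0 ≤ e := norm_nonneg _
  -- If `e ≥ d`, the noise contributes at most `lam * d * e / 2` and the bias strictly less than
  -- that, since `4 ‖f₀ - fbar‖ < d`. Their sum is below `lam * d * e ≤ lam * e²`, a contradiction.
  by_contra! hde
  have hd0 : 0 < d := by linarith [norm_nonneg (f₀ - fbar)]
  have h1 : 2 / m * ⟪A f - A f₀, s⟫ ≤ e * (lam * d / 2) := by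
    have h2 : ⟪A f - A f₀, s⟫ ≤ L * e * ‖s‖ :=
      (real_inner_le_norm _ _).trans (mul_le_mul_of_nonneg_right hL (norm_nonneg _))
    rw [div_mul_eq_mul_div, div_le_iff₀ hm']
    nlinarith
  have h3 : ⟪f₀ - fbar, f₀ - f⟫ ≤ ‖f₀ - fbar‖ * e := by
    rw [he, norm_sub_rev f f₀]
    exact real_inner_le_norm _ _
  have h4 : 0 ≤ 1 / (m : ℝ) * ∑ i, ‖(A f - A f₀) (z i).1‖ ^ 2 := by positivity
  have h5 : 0 < lam * e := mul_pos hlam (hd0.trans_le hde)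
  nlinarith

end Deterministic

section Model

variable {X Y H₁ H₂ : Type*}
  [MeasurableSpace X]
  [NormedAddCommGroup Y] [InnerProductSpace ℝ Y] [CompleteSpace Y] [SecondCountableTopology Y]
  [MeasurableSpace Y] [BorelSpace Y]
  [NormedAddCommGroup H₁] [InnerProductSpace ℝ H₁] [CompleteSpace H₁]
  [NormedAddCommGroup H₂] [InnerProductSpace ℝ H₂] [CompleteSpace H₂] [RKHS ℝ H₂ X Y]

/-- The source condition bounds the bias term. -/
theorem inner_source_le (hK : KernelAssumption H₂) (ν : Measure X) [IsFiniteMeasure ν]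
    {D : Set H₁} {A : H₁ → H₂} {f₀ fbar g f : H₁} {d L γ : ℝ}
    (hA : NonlinearityAssumption hK ν D A f₀ d L γ) (hf : f ∈ D) (hfd : ‖f - f₀‖ < d)
    (hg : f₀ - fbar = opSqrt (opT hK ν D A f₀) (opT_isPositive hK ν D A f₀) g) :
    ⟪f₀ - fbar, f₀ - f⟫ ≤
      ‖g‖ * (‖IK hK ν (A f - A f₀)‖ + γ / 2 * ‖f - f₀‖ ^ 2) := by
  have h1 : ‖opB hK ν D A f₀ (f - f₀)‖ ≤
      ‖IK hK ν (A f - A f₀)‖ + γ / 2 * ‖f - f₀‖ ^ 2 := by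
    have h2 := hA.norm_remainder_le f ⟨by rwa [Metric.mem_ball, dist_eq_norm], hf⟩
    have h3 : opB hK ν D A f₀ (f - f₀) = IK hK ν (A f - A f₀) -
        IK hK ν (A f - A f₀ - fderivWithin ℝ A D f₀ (f - f₀)) := by
      rw [map_sub _ (A f - A f₀) _]
      simp [opB]
    rw [h3]
    exact (norm_sub_le _ _).trans (by gcongr)
  rw [hg, (opSqrt_isPositive (opT hK ν D A f₀)
    (opT_isPositive hK ν D A f₀)).inner_left_eq_inner_right]
  refine (real_inner_le_norm _ _).trans ?_
  gcongr
  have h4 : ‖opSqrt (opT hK ν D A f₀) (opT_isPositive hK ν D A f₀) (f₀ - f)‖ =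
      ‖opB hK ν D A f₀ (f₀ - f)‖ :=
    norm_opSqrt_adjoint_comp_self_apply (opB hK ν D A f₀) (opT_isPositive hK ν D A f₀) _
  rw [h4, ← neg_sub, map_neg, norm_neg]
  exact h1

omit [CompleteSpace H₁] in
-- Insert `Q G = 1` to get `⟪u, s⟫ = ⟪G u, Q s⟫`, then use `‖G u‖² = ‖I_K u‖² + lam ‖u‖²`.
theorem noise_term_le (hK : KernelAssumption H₂) (ν : Measure X) [IsFiniteMeasure ν]
    {lam : ℝ} (hlam : 0 < lam) {G Q : H₂ →L[ℝ] H₂} (hG : G.adjoint = G) (hQ : Q.adjoint = Q)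
    (hGG : G * G = LK hK ν + lam • 1) (hQG : Q * G = 1) (u s : H₂) {t : ℝ} (hu : ‖u‖ ≤ t) :
    ⟪u, s⟫ ≤ (‖IK hK ν u‖ + √lam * t) * ‖Q s‖ := by
  have h1 : ⟪u, s⟫ = ⟪G u, Q s⟫ := by
    nth_rw 1 [← hQ]
    rw [ContinuousLinearMap.adjoint_inner_right]
    change _ = ⟪(Q * G) u, s⟫
    rw [hQG]
    rfl
  have h2 : ‖G u‖ ^ 2 = ‖IK hK ν u‖ ^ 2 + lam * ‖u‖ ^ 2 := by
    rw [← real_inner_self_eq_norm_sq]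
    nth_rw 1 [← hG]
    rw [ContinuousLinearMap.adjoint_inner_left]
    change ⟪u, (G * G) u⟫ = _
    rw [hGG, ← inner_LK_self]
    simp [inner_add_right, inner_smul_right, real_inner_comm]
  have ht : 0 ≤ t := (norm_nonneg u).trans hu
  have h3 : ‖G u‖ ≤ ‖IK hK ν u‖ + √lam * t := by
    refine abs_le_of_sq_le_sq' ?_ (by positivity) |>.2
    have h4 : ‖u‖ ^ 2 ≤ t ^ 2 := by gcongr
    have h5 : (√lam * t) ^ 2 = lam * t ^ 2 := by rw [mul_pow, Real.sq_sqrt hlam.le]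
    have h6 : 0 ≤ ‖IK hK ν u‖ * (√lam * t) := by positivity
    nlinarith
  rw [h1]
  refine (real_inner_le_norm _ _).trans ?_
  gcongr

end Model

/-! ### The error bound with high probability -/

section Model

variable {X Y H₁ H₂ : Type*}
  [MeasurableSpace X]
  [NormedAddCommGroup Y] [InnerProductSpace ℝ Y] [CompleteSpace Y] [SecondCountableTopology Y]
  [MeasurableSpace Y] [BorelSpace Y]
  [NormedAddCommGroup H₁] [InnerProductSpace ℝ H₁] [CompleteSpace H₁]
  [NormedAddCommGroup H₂] [InnerProductSpace ℝ H₂] [CompleteSpace H₂] [RKHS ℝ H₂ X Y]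

omit [CompleteSpace H₁] in
theorem NonlinearityAssumption.lipschitz_const_nonneg {hK : KernelAssumption H₂}
    {ν : Measure X} [IsFiniteMeasure ν] {D : Set H₁} {A : H₁ → H₂} {f₀ : H₁} {d L γ : ℝ}
    (hA : NonlinearityAssumption hK ν D A f₀ d L γ) (hf₀ : f₀ ∈ D) (hd : 0 < d) : 0 ≤ L :=
  (norm_nonneg _).trans (hA.norm_fderiv_le f₀ ⟨Metric.mem_ball_self hd, hf₀⟩)

/-- The error bounds on the event where the three empirical quantities are small. -/
theorem IsTikhonovEstimator.error_le {hK : KernelAssumption H₂}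
    {ρ : Measure (X × Y)} [IsProbabilityMeasure ρ]
    {D : Set H₁} {A : H₁ → H₂} {f₀ fbar g f : H₁} {d L γ R lam P : ℝ} {m : ℕ}
    {z : Fin m → X × Y} (hf : IsTikhonovEstimator D A fbar lam z f)
    (hf₀ : f₀ ∈ D) (hlam : 0 < lam) (hm : 0 < m)
    (hA : NonlinearityAssumption hK ρ.fst D A f₀ d L γ) (hd : 4 * ‖f₀ - fbar‖ < d)
    (hg : f₀ - fbar = opSqrt (opT hK ρ.fst D A f₀) (opT_isPositive hK ρ.fst D A f₀) g)
    (hgR : ‖g‖ ≤ R) (hγg : 2 * γ * ‖g‖ < 1)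
    (hs : 4 * L * ‖∑ i, noiseVec (A f₀) (ContinuousLinearMap.id ℝ H₂) (z i)‖ ≤ m * lam * d)
    {G Q : H₂ →L[ℝ] H₂} (hG : G.adjoint = G) (hQ : Q.adjoint = Q)
    (hGG : G * G = LK hK ρ.fst + lam • 1) (hQG : Q * G = 1)
    (hQs : ‖∑ i, noiseVec (A f₀) Q (z i)‖ ≤ m * P)
    (hcov : ∀ u : H₂, m * ‖IK hK ρ.fst u‖ ^ 2 - 3 / 2 * (m * lam) * ‖u‖ ^ 2 ≤
      ∑ i, ‖u (z i).1‖ ^ 2) :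
    ‖IK hK ρ.fst (A f - A f₀)‖ ≤ 3 * (6 * L ^ 2 + 1) * (P + lam * R) ∧
      √lam * ‖f - f₀‖ ≤ 6 * (6 * L ^ 2 + 1) * (P + lam * R) := by
  have hd0 : 0 < d := by linarith [norm_nonneg (f₀ - fbar)]
  have hL0 := hA.lipschitz_const_nonneg hf₀ hd0
  have hLip := hA.lipschitz f hf.1 f₀ hf₀
  have hfd := hf.norm_sub_lt hf₀ hlam hm hLip hd hs
  have hsrc := inner_source_le hK ρ.fst hA hf.1 hfd hg
  have hb := hf.basic_inequality hf₀
  have hnoise := noise_term_le hK ρ.fst hlam hG hQ hGG hQG (A f - A f₀)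
    (∑ i, noiseVec (A f₀) (ContinuousLinearMap.id ℝ H₂) (z i)) hLip
  have hQsum : Q (∑ i, noiseVec (A f₀) (ContinuousLinearMap.id ℝ H₂) (z i)) =
      ∑ i, noiseVec (A f₀) Q (z i) := by
    rw [map_sum]
    refine Finset.sum_congr rfl fun i _ => ?_
    rw [noiseVec, noiseVec, hQ, ContinuousLinearMap.adjoint_id]
    rfl
  rw [hQsum] at hnoise
  have hc := hcov (A f - A f₀)
  set a := ‖IK hK ρ.fst (A f - A f₀)‖ with ha
  set e := ‖f - f₀‖ with he
  set v := √lam * e with hv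
  have hm' : (0 : ℝ) < m := by exact_mod_cast hm
  have ha0 : 0 ≤ a := norm_nonneg _
  have he0 : 0 ≤ e := norm_nonneg _
  have hv0 : 0 ≤ v := by positivity
  have hv2 : v ^ 2 = lam * e ^ 2 := by rw [hv, mul_pow, Real.sq_sqrt hlam.le]
  have hP0 : 0 ≤ P := by
    have := (norm_nonneg _).trans hQs
    exact nonneg_of_mul_nonneg_right this hm'
  have hR0 : 0 ≤ R := (norm_nonneg g).trans hgR
  refine bounds_of_quadratic_inequality
    (q := 1 / (m : ℝ) * ∑ i, ‖(A f - A f₀) (z i).1‖ ^ 2) (by positivity) (by positivity) ?_ ?_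
  · have h1 : ‖A f - A f₀‖ ^ 2 ≤ (L * e) ^ 2 := by gcongr
    rw [one_div, le_inv_mul_iff₀ hm']
    refine le_trans ?_ hc
    rw [hv2]
    have := mul_le_mul_of_nonneg_left h1 (by positivity : 0 ≤ 3 / 2 * (m * lam))
    nlinarith
  · have h1 : 2 / m * ⟪A f - A f₀, ∑ i, noiseVec (A f₀) (ContinuousLinearMap.id ℝ H₂) (z i)⟫ ≤
        2 * P * (a + L * v) := by
      rw [div_mul_eq_mul_div, div_le_iff₀ hm']
      have h2 : (a + √lam * (L * e)) * ‖∑ i, noiseVec (A f₀) Q (z i)‖ ≤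
          (a + √lam * (L * e)) * (m * P) := by gcongr
      have h3 : √lam * (L * e) = L * v := by rw [hv]; ring
      rw [h3] at h2 hnoise
      linarith
    have h4 : 2 * lam * ⟪f₀ - fbar, f₀ - f⟫ ≤ 2 * (lam * R) * a + v ^ 2 / 2 := by
      have h5 : ‖g‖ * a ≤ R * a := by gcongr
      -- The smallness condition limits the curvature contribution `lam * γ * ‖g‖ * e²` to half of
      -- the penalty.
      have h6 : 2 * γ * ‖g‖ * (lam * e ^ 2) ≤ 1 * (lam * e ^ 2) := by gcongr
      rw [hv2]
      nlinarith [mul_le_mul_of_nonneg_left hsrc (by positivity : 0 ≤ 2 * lam)]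
    -- Enlarging the bias factor from `a` to `a + L * v` lets noise and bias share the factor of `W
    -- = P + lam * R`.
    have h7 : 0 ≤ lam * R * (L * v) := by positivity
    have h8 : lam * e ^ 2 = v ^ 2 := hv2.symm
    rw [h8] at hb
    nlinarith

theorem errorBound_nonneg (hK : KernelAssumption H₂) (ν : Measure X) [IsFiniteMeasure ν]
    {R M Sig lam : ℝ} (hR : 0 ≤ R) (hM : 0 ≤ M) (hlam : 0 ≤ lam) (m : ℕ) :
    0 ≤ errorBound hK ν R M Sig lam m := by
  have := kappa_nonneg (H := H₂)
  unfold errorBound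
  positivity

omit [SecondCountableTopology Y] [MeasurableSpace Y] [BorelSpace Y] in
theorem eq_zero_of_kappa_eq_zero (hK : KernelAssumption H₂) (hκ : kappa H₂ = 0) (u : H₂) :
    u = 0 := by
  refine RKHS.ext fun x => ?_
  have := norm_eval_le hK.kappaSq_lt_top u x
  rw [hκ, zero_mul] at this
  simpa using this

variable [TopologicalSpace.SeparableSpace H₂]

/-- A sample is good, with high probability: the noise terms and the deviation of the empirical
covariance operator are small. -/
theorem exists_good_event (hK : KernelAssumption H₂) (ρ : Measure (X × Y)) [IsProbabilityMeasure ρ]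
    {h : H₂} {M Sig lam η : ℝ} (hM : 0 < M) (hSig : 0 < Sig) (hlam : 0 < lam) (hη : 0 < η)
    (hη1 : η < 1) (hκ : 0 < kappa H₂)
    (hi : ∀ᵐ x ∂ρ.fst, Integrable (fun y : Y => y) (ρ.condKernel x))
    (hmean : ∀ᵐ x ∂ρ.fst, ∫ y, y ∂(ρ.condKernel x) = h x)
    (hnoise : ∀ᵐ x ∂ρ.fst, ∫⁻ y, ENNReal.ofReal (expRem (‖y - h x‖ / M)) ∂(ρ.condKernel x)
      ≤ ENNReal.ofReal (Sig ^ 2 / (2 * M ^ 2)))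
    {Q : H₂ →L[ℝ] H₂} (hQ : Q.adjoint = Q)
    (hQQ : Q * Q = Ring.inverse (LK hK ρ.fst + lam • 1))
    (hQL : Q * LK hK ρ.fst = LK hK ρ.fst * Q) (hQn : ‖Q‖ ≤ 1 / √lam) (m : ℕ) :
    ∃ E : Set (Fin m → X × Y), MeasurableSet E ∧
      ENNReal.ofReal (1 - η) ≤ Measure.pi (fun _ : Fin m => ρ) E ∧
      ∀ z ∈ E,
        ‖∑ i, noiseVec h (ContinuousLinearMap.id ℝ H₂) (z i)‖ ≤
          2 * (kappa H₂ * M + kappa H₂ * Sig * √m) * Real.log (4 / η) ∧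
        ‖∑ i, noiseVec h Q (z i)‖ ≤
          2 * (kappa H₂ / √lam * M + √(effectiveDim hK ρ.fst lam) * Sig * √m)
            * Real.log (4 / η) ∧
        ‖∑ i, centeredCovVec ρ hK (z i)‖ ≤
          2 * (2 * kappa H₂ ^ 2 + 4 * kappa H₂ ^ 2 * √m) * Real.log (4 / η) := by
  set l := Real.log (4 / η) with hl
  have hN0 : 0 ≤ effectiveDim hK ρ.fst lam := by
    rw [effectiveDim_eq_tsum hK ρ.fst hQ hQQ hQL]
    positivity
  have hid : ∫⁻ x, evalHSSq (ContinuousLinearMap.id ℝ H₂) x ∂ρ.fst ≤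
      ENNReal.ofReal (kappa H₂ ^ 2) := by
    calc _ ≤ ∫⁻ _, ENNReal.ofReal (kappa H₂ ^ 2) ∂ρ.fst := by
          refine lintegral_mono fun x => (evalHSSq_le hK.kappaSq_lt_top _ x).trans
            (ENNReal.ofReal_le_ofReal ?_)
          gcongr
          exact mul_le_of_le_one_left hκ.le ContinuousLinearMap.norm_id_le
      _ = _ := by simp
  -- For the unweighted noise, `κ` is the uniform bound and `κ²` the integrated one; for `Q` below
  -- these become `κ / √lam` and the effective dimension.
  have hE1 := measure_norm_sum_noiseVec_ge_le hK hM hSig hi hmean hnoise hκ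
    (mul_le_of_le_one_left hκ.le ContinuousLinearMap.norm_id_le) (sq_nonneg _) hid m l
  rw [Real.sqrt_sq hκ.le] at hE1
  have hE2 := measure_norm_sum_noiseVec_ge_le hK hM hSig hi hmean hnoise
    (S := Q) (s := kappa H₂ / √lam) (by positivity)
    (by rw [div_eq_mul_one_div, mul_comm]; gcongr) hN0
    (lintegral_evalHSSq_eq_effectiveDim hK ρ.fst hQ hQQ hQL).le m l
  have hE3 := measure_norm_sum_centeredCovVec_ge_le ρ hK hκ m l
  have hm1 := (stronglyMeasurable_sum_pi
    (stronglyMeasurable_noiseVec hK h (ContinuousLinearMap.id ℝ H₂)) m).norm.measurable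
  have hm2 := (stronglyMeasurable_sum_pi (stronglyMeasurable_noiseVec hK h Q) m).norm.measurable
  have hm3 := (stronglyMeasurable_sum_pi
    (stronglyMeasurable_centeredCovVec ρ hK) m).norm.measurable
  have hs1 := measurableSet_le (measurable_const (a := 2 * (kappa H₂ * M + kappa H₂ * Sig * √m) * l))
    hm1
  have hs2 := measurableSet_le (measurable_const
    (a := 2 * (kappa H₂ / √lam * M + √(effectiveDim hK ρ.fst lam) * Sig * √m) * l)) hm2
  have hs3 := measurableSet_le (measurable_const
    (a := 2 * (2 * kappa H₂ ^ 2 + 4 * kappa H₂ ^ 2 * √m) * l)) hm3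
  refine ⟨_, ((hs1.union hs2).union hs3).compl, ?_, fun z hz => ?_⟩
  · rw [prob_compl_eq_one_sub ((hs1.union hs2).union hs3), ENNReal.ofReal_sub _ hη.le,
      ENNReal.ofReal_one]
    refine tsub_le_tsub_left ?_ _
    refine (measure_union_le _ _).trans ((add_le_add ((measure_union_le _ _).trans
      (add_le_add hE1 hE2)) hE3).trans ?_)
    rw [← ENNReal.ofReal_add (by positivity) (by positivity),
      ← ENNReal.ofReal_add (by positivity) (by positivity)]
    refine ENNReal.ofReal_le_ofReal ?_
    -- Each tail is at most `2 * 2 * (η / 4)²`, using `exp (1/2) ≤ 2`; three of them give `(3/4) η²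
    -- ≤ η`.
    have h1 : Real.exp (-(2 * l)) = (η / 4) ^ 2 := by
      have h2 : -(2 * l) = ((2 : ℕ) : ℝ) * Real.log (η / 4) := by
        have : Real.log (η / 4) = -l := by rw [hl, ← Real.log_inv, inv_div]
        rw [this]
        push_cast
        ring
      rw [h2, Real.exp_nat_mul, Real.exp_log (by positivity)]
    have h3 : Real.exp (1 / 2) ≤ 2 := by
      have h4 : Real.exp (1 / 2) ^ 2 = Real.exp 1 := by
        rw [← Real.exp_nat_mul]; norm_num
      have h5 := Real.exp_one_lt_d9
      nlinarith [Real.exp_pos (1 / 2)]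
    rw [h1]
    have h6 : η ^ 2 ≤ η := by nlinarith
    nlinarith [sq_nonneg η]
  · simp only [Set.mem_compl_iff, Set.mem_union, Set.mem_ofPred_eq, not_or, not_le] at hz
    exact ⟨hz.1.1.le, hz.1.2.le, hz.2.le⟩

end Model

end StatInv

end

/-! ### Assembly: sample size condition and final constants. -/

theorem mainTheorem3 (γ L R : ℝ) (hγ : 0 ≤ γ) (hR : 0 < R) :
    ∃ C₁ C₂ : ℝ, 0 < C₁ ∧ 0 < C₂ ∧
    ∀ (X Y H₁ H₂ : Type*)
      [TopologicalSpace X] [PolishSpace X] [MeasurableSpace X] [BorelSpace X]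
      [NormedAddCommGroup Y] [InnerProductSpace ℝ Y] [CompleteSpace Y]
      [SecondCountableTopology Y] [MeasurableSpace Y] [BorelSpace Y]
      [NormedAddCommGroup H₁] [InnerProductSpace ℝ H₁] [CompleteSpace H₁]
      [TopologicalSpace.SeparableSpace H₁]
      [NormedAddCommGroup H₂] [InnerProductSpace ℝ H₂] [CompleteSpace H₂]
      [TopologicalSpace.SeparableSpace H₂]
      [RKHS ℝ H₂ X Y] (hK : StatInv.KernelAssumption H₂)
      (ρ : MeasureTheory.Measure (X × Y)) [MeasureTheory.IsProbabilityMeasure ρ]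
      (D : Set H₁) (A : H₁ → H₂) (fρ fbar g : H₁) (d M Sig lam η : ℝ) (m : ℕ),
      0 < M → 0 < Sig → 0 < lam → 0 < m → 0 < η → η < 1 →
      StatInv.IsTrueSolution ρ D A fρ →
      StatInv.NoiseCondition ρ A fρ M Sig →
      StatInv.NonlinearityAssumption hK ρ.fst D A fρ d L γ →
      4 * ‖fρ - fbar‖ < d →
      fρ - fbar =
        StatInv.opSqrt (StatInv.opT hK ρ.fst D A fρ) (StatInv.opT_isPositive hK ρ.fst D A fρ) g →
      ‖g‖ ≤ R →
      2 * γ * ‖g‖ < 1 →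
      8 * StatInv.kappa H₂ ^ 2 * max 1 (L * (M + Sig) / (StatInv.kappa H₂ * d))
        * Real.log (4 / η) ≤ √(m : ℝ) * lam →
      ∃ E : Set (Fin m → X × Y), MeasurableSet E ∧
        ENNReal.ofReal (1 - η) ≤ MeasureTheory.Measure.pi (fun _ : Fin m => ρ) E ∧
        ∀ z ∈ E, ∀ f : H₁, StatInv.IsTikhonovEstimator D A fbar lam z f →
          ‖f - fρ‖ ≤ C₁ * StatInv.errorBound hK ρ.fst R M Sig lam m * Real.log (4 / η) ∧
          ‖StatInv.IK hK ρ.fst (A f - A fρ)‖ ≤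
            C₂ * √lam * StatInv.errorBound hK ρ.fst R M Sig lam m * Real.log (4 / η) := by
  -- Twice the constants of `error_le`; the factor 2 comes from `hW`.
  refine ⟨12 * (6 * L ^ 2 + 1), 6 * (6 * L ^ 2 + 1), by positivity, by positivity, ?_⟩
  intro X Y H₁ H₂ _ _ _ _ _ _ _ _ _ _ _ _ _ _ _ _ _ _ _ hK ρ _ D A fρ fbar g d M Sig lam η m
    hM hSig hlam hm hη hη1 hsol hnoise hA hd hg hgR hγg hsize
  have hl : 1 ≤ Real.log (4 / η) := by
    rw [Real.le_log_iff_exp_le (by positivity), le_div_iff₀ hη]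
    have := Real.exp_one_lt_d9
    nlinarith [Real.exp_pos 1]
  have hfD : fρ ∈ D := interior_subset hsol.mem_interior
  have hm' : (0 : ℝ) < m := by exact_mod_cast hm
  have hEB := StatInv.errorBound_nonneg (Sig := Sig) hK ρ.fst hR.le hM.le hlam.le m
  -- For `κ = 0` the kernel space is trivial and injectivity of `A` forces `f = fρ`. This case is
  -- separate because the sample size condition divides by `κ`.
  rcases eq_or_lt_of_le (StatInv.kappa_nonneg (H := H₂)) with hκ | hκ
  · refine ⟨Set.univ, MeasurableSet.univ, ?_, fun z _ f hf => ?_⟩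
    · rw [measure_univ]
      exact ENNReal.ofReal_le_one.2 (by linarith)
    · have hff : f = fρ := hA.injOn hf.1 hfD <| by
        rw [StatInv.eq_zero_of_kappa_eq_zero hK hκ.symm (A f),
          StatInv.eq_zero_of_kappa_eq_zero hK hκ.symm (A fρ)]
      rw [hff]
      simp only [sub_self, map_zero, norm_zero]
      constructor <;> positivity
  have hd0 : 0 < d := by linarith [norm_nonneg (fρ - fbar)]
  have hL0 : 0 ≤ L := hA.lipschitz_const_nonneg hfD hd0
  obtain ⟨G, Q, hG, hQ, hGG, hQG, hQQ, hQL, hQn⟩ :=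
    StatInv.exists_sqrt_add_smul_one (StatInv.LK_isPositive hK ρ.fst) hlam
  obtain ⟨E, hEm, hEp, hE⟩ := StatInv.exists_good_event hK ρ hM hSig hlam hη hη1 hκ
    hsol.integrable hsol.condMean_eq hnoise hQ hQQ hQL hQn m
  refine ⟨E, hEm, hEp, fun z hz f hf => ?_⟩
  obtain ⟨h1, h2, h3⟩ := hE z hz
  set κ := StatInv.kappa H₂ with hκdef
  set l := Real.log (4 / η) with hldef
  have hsm : 1 ≤ √(m : ℝ) := Real.one_le_sqrt.2 (by exact_mod_cast hm)
  have hsm2 : √(m : ℝ) * √(m : ℝ) = m := Real.mul_self_sqrt hm'.le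
  have hsl : 0 < √lam := Real.sqrt_pos.2 hlam
  have hsl2 : √lam * √lam = lam := Real.mul_self_sqrt hlam.le
  have hsize1 : 8 * κ ^ 2 * l ≤ √m * lam := by
    refine le_trans ?_ hsize
    have : 8 * κ ^ 2 * 1 * l ≤ 8 * κ ^ 2 * max 1 (L * (M + Sig) / (κ * d)) * l := by
      gcongr
      exact le_max_left _ _
    linarith
  have hsize2 : 8 * κ * (L * (M + Sig)) * l ≤ √m * lam * d := by
    have h4 : 8 * κ ^ 2 * (L * (M + Sig) / (κ * d)) * l ≤ √m * lam := by
      refine le_trans ?_ hsize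
      gcongr
      exact le_max_right _ _
    have h5 : 8 * κ ^ 2 * (L * (M + Sig) / (κ * d)) * l = 8 * κ * (L * (M + Sig)) * l / d := by
      field_simp
    rw [h5, div_le_iff₀ hd0] at h4
    exact h4
  have key := hf.error_le (P := 2 * (κ * M / (m * √lam) +
      √(StatInv.effectiveDim hK ρ.fst lam) * Sig / √m) * l)
    hfD hlam hm hA hd hg hgR hγg ?_ hG hQ hGG hQG ?_ ?_
  · have hroot : √(Sig ^ 2 * StatInv.effectiveDim hK ρ.fst lam / (m * lam)) =
        √(StatInv.effectiveDim hK ρ.fst lam) * Sig / (√m * √lam) := by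
      rw [Real.sqrt_div' _ (by positivity), Real.sqrt_mul (sq_nonneg _), Real.sqrt_sq hSig.le,
        Real.sqrt_mul hm'.le, mul_comm Sig]
    have hW : 2 * (κ * M / (m * √lam) + √(StatInv.effectiveDim hK ρ.fst lam) * Sig / √m) * l
        + lam * R ≤ 2 * (√lam * StatInv.errorBound hK ρ.fst R M Sig lam m * l) := by
      have h4 : √lam * StatInv.errorBound hK ρ.fst R M Sig lam m = lam * R + (κ * M / (m * √lam) +
          √(StatInv.effectiveDim hK ρ.fst lam) * Sig / √m) := by
        have h5 : κ * M / (m * lam) = κ * M / (m * √lam) / √lam := by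
          rw [div_div, mul_assoc, hsl2]
        have h6 : √(StatInv.effectiveDim hK ρ.fst lam) * Sig / (√m * √lam) =
          √(StatInv.effectiveDim hK ρ.fst lam) * Sig / √m / √lam := by rw [div_div]
        rw [StatInv.errorBound, hroot, h5, h6, mul_add, mul_add, mul_div_cancel₀ _ hsl.ne',
          mul_div_cancel₀ _ hsl.ne']
        linear_combination R * hsl2
      rw [h4]
      -- Together with `hl`, this lets the deterministic term `lam * R` be placed under the
      -- logarithmic factor.
      have : 0 ≤ lam * R := by positivity
      nlinarith
    obtain ⟨k1, k2⟩ := key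
    have hk : 0 ≤ 6 * L ^ 2 + 1 := by positivity
    have hW' := mul_le_mul_of_nonneg_left hW hk
    constructor
    · refine le_of_mul_le_mul_left ?_ hsl
      linarith
    · linarith
  · refine (mul_le_mul_of_nonneg_left h1 (by positivity)).trans ?_
    have h4 : κ * M + κ * Sig * √m ≤ κ * (M + Sig) * √m := by
      have : κ * M * 1 ≤ κ * M * √m := by gcongr
      linarith
    have h5 := mul_le_mul_of_nonneg_left h4 (by positivity : 0 ≤ 8 * L * l)
    have h6 := mul_le_mul_of_nonneg_left hsize2 (Real.sqrt_nonneg (m : ℝ))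
    calc 4 * L * (2 * (κ * M + κ * Sig * √m) * l) = 8 * L * l * (κ * M + κ * Sig * √m) := by ring
      _ ≤ 8 * L * l * (κ * (M + Sig) * √m) := h5
      _ = √m * (8 * κ * (L * (M + Sig)) * l) := by ring
      _ ≤ √m * (√m * lam * d) := h6
      _ = √m * √m * lam * d := by ring
      _ = m * lam * d := by rw [hsm2]
  · refine h2.trans (le_of_eq ?_)
    have h4 : (m : ℝ) * (κ * M / (m * √lam)) = κ / √lam * M := by field_simp
    have h5 : (m : ℝ) * (√(StatInv.effectiveDim hK ρ.fst lam) * Sig / √m) =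
        √(StatInv.effectiveDim hK ρ.fst lam) * Sig * √m := by
      rw [mul_div_assoc', mul_comm (m : ℝ), mul_div_assoc, Real.div_sqrt]
    linear_combination (-2 * l) * h4 - 2 * l * h5
  · intro u
    refine le_trans ?_ (StatInv.le_sum_norm_apply_sq ρ hK z h3 u)
    -- Origin of the constant `3 / 2`: the deviation is at most `12 κ² √m l`, and `8 κ² l ≤ √m lam`.
    have h4 : 2 * (2 * κ ^ 2 + 4 * κ ^ 2 * √m) * l ≤ 3 / 2 * (m * lam) := by
      have h5 : 2 * κ ^ 2 * 1 ≤ 2 * κ ^ 2 * √m := by gcongr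
      calc 2 * (2 * κ ^ 2 + 4 * κ ^ 2 * √m) * l ≤ 2 * (2 * κ ^ 2 * √m + 4 * κ ^ 2 * √m) * l := by
            refine mul_le_mul_of_nonneg_right ?_ (by positivity)
            linarith
        _ = 3 / 2 * (√m * (8 * κ ^ 2 * l)) := by ring
        _ ≤ 3 / 2 * (√m * (√m * lam)) := by gcongr
        _ = 3 / 2 * (√m * √m * lam) := by ring
        _ = _ := by rw [hsm2]
    have := mul_le_mul_of_nonneg_right h4 (sq_nonneg ‖u‖)
    linarith
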